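/- Let $X$ be a second-countable locally compact Hausdorff space and let $\kappa:X\times X\to[0,\infty]$ be a symmetric, lower semicontinuous kernel. For positive Radon measures $\mu,\nu$ on $X$ put $U^\mu(x)=\int\kappa(x,y)\,d\mu(y)$, $I(\mu,\nu)=\int\kappa\,d(\mu\otimes\nu)$, $I(\mu)=I(\mu,\mu)$ (and likewise for signed Radon measures, whenever the integrals are well defined). Let $\mathcal E$ be the space of signed Radon measures of finite energy, $\mathcal E^+$ the cone of positive measures in $\mathcal E$, and, for $A\subset X$, let $\mathcal E^+(A)$ be the set of $\mu\in\mathcal E^+$ concentrated on $A$ (i.e. $X\setminus A$ is $\mu$-negligible), and $\breve{\mathcal E}^+(A)=\{\mu\in\mathcal E^+(A):\mu(X)=1\}$. The inner capacity of $A$ is $$c_*(A)=\sup_{K\subset A\text{ compact}}\ \Bigl(\inf\bigl\{I(\mu):\ \mu\ge0,\ \mu(X)=1,\ \mu(X\setminus K)=0\bigr\}\Bigr)^{-1},$$ and a property holds nearly everywhere (n.e.) on $A$ if the set of points of $A$ where it fails has inner capacity zero. Assume that $\kappa$ satisfies: * the energy principle: $I(\mu)\ge0$ for every signed Radon measure $\mu$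 for which $I(\mu)$ is well defined, with equality only for $\mu=0$; so $\|\mu\|=\sqrt{I(\mu)}$ is a norm on $\mathcal E$ and defines the strong topology; * the consistency principle: $\mathcal E^+$ is strongly complete, and the strong topology on $\mathcal E^+$ is finer than the vague topology; * the domination principle: if $\mu\in\mathcal E^+$, $\nu$ is a positive Radon measure and $U^\mu\le U^\nu$ $\mu$-a.e., then $U^\mu\le U^\nu$ on $X$; * Ugaheri's maximum principle: there is $M\in[1,\infty)$ such that, for all $\mu\in\mathcal E^+$ and $c\in(0,\infty)$, $U^\mu\le c$ $\mu$-a.e. implies $U^\mu\le Mc$ on $X$. (For $M=1$ this is Frostman's maximum principle.) Let $A\subset X$ be a set with $c_*(A)>0$ such that $\mathcal E^+(A)$ is strongly closed, and let $\omega\neq0$ be a positive Radon measure on $X$ such that either $\omega\in\mathcal E^+$, or $\omega(X)<\infty$, $U^\omega$ is bounded on $A$, and $U^\omega|_K$ is upper semicontinuous for every compact $K\subset A$. Then there is exactly one measure $\omega^A\in\mathcal E^+(A)$ with $U^{\omega^A}=U^\omega$ n.e. on $A$; it is called the inner balayage of $\omega$ onto $A$. Put $f=-U^\omega$ and $I_f(\mu)=I(\mu)-2\int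 U^\omega\,d\mu$. A solution of the inner Gauss variational problem is a measure $\lambda_{A,f}\in\breve{\mathcal E}^+(A)$ with $$I_f(\lambda_{A,f})=\inf_{\mu\in\breve{\mathcal E}^+(A)}I_f(\mu);$$ it is unique if it exists. **Theorem.** * (i$_1$) If $c_*(A)<\infty$ or $\omega^A(X)=1$, then the solution $\lambda_{A,f}$ exists; if $\omega^A(X)=1$, then $\lambda_{A,f}=\omega^A$. * (ii$_1$) If $c_*(A)=\infty$ and $\omega^A(X)<1$, then no solution $\lambda_{A,f}$ exists. * (iii$_1$) If Frostman's maximum principle holds and $\omega^A(X)>1$, then the solution $\lambda_{A,f}$ exists. -/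

import Mathlib

open MeasureTheory Set Filter Topology
open scoped ENNReal NNReal

noncomputable section

namespace PotentialTheory

variable {X : Type*} [TopologicalSpace X] [MeasurableSpace X]

/-- A kernel on `X`: a symmetric, lower semicontinuous function `X × X → [0, ∞]`. -/
structure IsKernel (κ : X → X → ℝ≥0∞) : Prop where
  symm : ∀ x y, κ x y = κ y x
  lsc : LowerSemicontinuous fun p : X × X => κ p.1 p.2

/-- The cone of positive Radon measures on `X`. On a second-countable, locally compact Hausdorff
space these are exactly the Borel measures that are finite on compact sets. -/
def radonCone (X : Type*) [TopologicalSpace X] [MeasurableSpace X] : Set (Measure X) :=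
  {μ | IsFiniteMeasureOnCompacts μ}

/-- The potential `U^μ(x) = ∫ κ(x, y) dμ(y)` of a positive measure. -/
def potential (κ : X → X → ℝ≥0∞) (μ : Measure X) (x : X) : ℝ≥0∞ :=
  ∫⁻ y, κ x y ∂μ

/-- The mutual energy `I(μ, ν) = ∫ κ d(μ ⊗ ν)` of positive measures. -/
def mutualEnergy (κ : X → X → ℝ≥0∞) (μ ν : Measure X) : ℝ≥0∞ :=
  ∫⁻ p : X × X, κ p.1 p.2 ∂(μ.prod ν)

/-- The energy `I(μ) = I(μ, μ)` of a positive measure. -/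
def energy (κ : X → X → ℝ≥0∞) (μ : Measure X) : ℝ≥0∞ :=
  mutualEnergy κ μ μ

/-- The cone of positive Radon measures of finite energy. -/
def finiteEnergyCone (κ : X → X → ℝ≥0∞) : Set (Measure X) :=
  {μ | μ ∈ radonCone X ∧ energy κ μ < ∞}

/-- The measures in `finiteEnergyCone κ` that are concentrated on the (arbitrary) set `A`,
that is, for which the complement of `A` has outer measure zero. -/
def finiteEnergyConeOn (κ : X → X → ℝ≥0∞) (A : Set X) : Set (Measure X) :=
  {μ | μ ∈ finiteEnergyCone κ ∧ μ Aᶜ = 0}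

/-- The measures in `finiteEnergyConeOn κ A` of total mass one. -/
def unitFiniteEnergyOn (κ : X → X → ℝ≥0∞) (A : Set X) : Set (Measure X) :=
  {μ | μ ∈ finiteEnergyConeOn κ A ∧ μ univ = 1}

/-- The energy principle (strict positive definiteness): a signed Radon measure `μ - ν`, with
`μ` and `ν` positive Radon measures of finite energy, has energy
`I(μ) + I(ν) - 2 I(μ, ν) ≥ 0`, and this energy vanishes only if `μ - ν = 0`. -/
def EnergyPrinciple (κ : X → X → ℝ≥0∞) : Prop :=
  ∀ μ ∈ finiteEnergyCone κ, ∀ ν ∈ finiteEnergyCone κ,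
    2 * mutualEnergy κ μ ν ≤ energy κ μ + energy κ ν ∧
    (2 * mutualEnergy κ μ ν = energy κ μ + energy κ ν → μ = ν)

/-- The strong distance `‖μ - ν‖` between positive measures of finite energy, given by
`‖μ - ν‖² = I(μ) + I(ν) - 2 I(μ, ν)`; all these terms are finite under the energy principle. -/
def strongDist (κ : X → X → ℝ≥0∞) (μ ν : Measure X) : ℝ :=
  √((energy κ μ).toReal + (energy κ ν).toReal - 2 * (mutualEnergy κ μ ν).toReal)

/-- Strong convergence of a sequence of measures. -/
def StrongTendsto (κ : X → X → ℝ≥0∞) (μ : ℕ → Measure X) (ν : Measure X) : Prop :=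
  Tendsto (fun n => strongDist κ (μ n) ν) atTop (𝓝 0)

/-- Strong Cauchy sequences of measures. -/
def StrongCauchy (κ : X → X → ℝ≥0∞) (μ : ℕ → Measure X) : Prop :=
  ∀ ε > 0, ∃ N, ∀ m ≥ N, ∀ n ≥ N, strongDist κ (μ m) (μ n) < ε

/-- Vague convergence of a sequence of measures. -/
def VagueTendsto (μ : ℕ → Measure X) (ν : Measure X) : Prop :=
  ∀ φ : X → ℝ, Continuous φ → HasCompactSupport φ →
    Tendsto (fun n => ∫ x, φ x ∂(μ n)) atTop (𝓝 (∫ x, φ x ∂ν))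

/-- The consistency principle: the cone of positive measures of finite energy is strongly
complete, and the strong topology on it is finer than the vague topology. As the strong topology
is given by a metric, both properties are expressed through sequences. -/
structure ConsistencyPrinciple (κ : X → X → ℝ≥0∞) : Prop where
  complete : ∀ μ : ℕ → Measure X, (∀ n, μ n ∈ finiteEnergyCone κ) → StrongCauchy κ μ →
    ∃ ν ∈ finiteEnergyCone κ, StrongTendsto κ μ ν
  finer : ∀ μ : ℕ → Measure X, (∀ n, μ n ∈ finiteEnergyCone κ) → ∀ ν ∈ finiteEnergyCone κ,
    StrongTendsto κ μ ν → VagueTendsto μ ν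

/-- A kernel that satisfies the energy and the consistency principles. -/
structure IsPerfectKernel (κ : X → X → ℝ≥0∞) : Prop extends IsKernel κ where
  energy_principle : EnergyPrinciple κ
  consistency : ConsistencyPrinciple κ

/-- The domination principle. -/
def DominationPrinciple (κ : X → X → ℝ≥0∞) : Prop :=
  ∀ μ ∈ finiteEnergyCone κ, ∀ ν ∈ radonCone X,
    (∀ᵐ x ∂μ, potential κ μ x ≤ potential κ ν x) → ∀ x, potential κ μ x ≤ potential κ ν x

/-- Ugaheri's maximum principle with the constant `M`. -/
def UgaheriPrinciple (κ : X → X → ℝ≥0∞) (M : ℝ≥0) : Prop :=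
  ∀ μ ∈ finiteEnergyCone κ, ∀ c : ℝ≥0, 0 < c →
    (∀ᵐ x ∂μ, potential κ μ x ≤ c) → ∀ x, potential κ μ x ≤ M * c

/-- Frostman's maximum principle: Ugaheri's maximum principle with the constant one. -/
def FrostmanPrinciple (κ : X → X → ℝ≥0∞) : Prop :=
  UgaheriPrinciple κ 1

/-- The inner capacity of a set: the supremum, over compact subsets `K`, of the reciprocal of
the infimum of the energies of the positive measures of total mass one concentrated on `K`. -/
def innerCapacity (κ : X → X → ℝ≥0∞) (A : Set X) : ℝ≥0∞ :=
  ⨆ K : Set X, ⨆ _ : IsCompact K ∧ K ⊆ A,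
    (⨅ μ : Measure X, ⨅ _ : μ univ = 1 ∧ μ Kᶜ = 0, energy κ μ)⁻¹

/-- `P` holds nearly everywhere on `A`: the exceptional set has inner capacity zero. -/
def NearlyEverywhereOn (κ : X → X → ℝ≥0∞) (A : Set X) (P : X → Prop) : Prop :=
  innerCapacity κ {x | x ∈ A ∧ ¬ P x} = 0

/-- The class of positive measures of finite energy concentrated on `A` is strongly closed. -/
def IsStronglyClosedOn (κ : X → X → ℝ≥0∞) (A : Set X) : Prop :=
  ∀ μ : ℕ → Measure X, (∀ n, μ n ∈ finiteEnergyConeOn κ A) → ∀ ν ∈ finiteEnergyCone κ,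
    StrongTendsto κ μ ν → ν ∈ finiteEnergyConeOn κ A

/-- `ω` is bounded, its potential is upper semicontinuous on every compact subset of `A`, and its
potential is bounded on `A`. -/
structure IsAdmissibleCharge (κ : X → X → ℝ≥0∞) (A : Set X) (ω : Measure X) : Prop where
  bounded : ω univ < ∞
  usc : ∀ K : Set X, IsCompact K → K ⊆ A → UpperSemicontinuousOn (potential κ ω) K
  potential_bounded : ∃ m : ℝ≥0, ∀ x ∈ A, potential κ ω x ≤ m

/-- `ν` is the inner balayage of `ω` onto `A`: the measure of finite energy concentrated on `A`
whose potential equals that of `ω` nearly everywhere on `A`. -/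
structure IsInnerBalayage (κ : X → X → ℝ≥0∞) (A : Set X) (ω ν : Measure X) : Prop where
  mem : ν ∈ finiteEnergyConeOn κ A
  potential_eq : NearlyEverywhereOn κ A fun x => potential κ ν x = potential κ ω x

/-- The Gauss functional `I_f(μ) = I(μ) + 2 ∫ f dμ` with external field `f = -U^ω`. It takes
values in the extended reals; the difference is unambiguous as soon as `I(μ) < ∞`. -/
def gaussFunctional (κ : X → X → ℝ≥0∞) (ω μ : Measure X) : EReal :=
  (energy κ μ : EReal) - 2 * ((∫⁻ x, potential κ ω x ∂μ : ℝ≥0∞) : EReal)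

/-- `ν` solves the inner Gauss variational problem: it minimizes the Gauss functional over the
measures of finite energy and of total mass one concentrated on `A`. -/
structure IsGaussSolution (κ : X → X → ℝ≥0∞) (A : Set X) (ω ν : Measure X) : Prop where
  mem : ν ∈ unitFiniteEnergyOn κ A
  isMin : gaussFunctional κ ω ν = ⨅ μ ∈ unitFiniteEnergyOn κ A, gaussFunctional κ ω μ

end PotentialTheory

end

open PotentialTheory

noncomputable section

set_option linter.unusedSectionVars false

namespace PotentialTheory

variable {X : Type*} [TopologicalSpace X] [T2Space X] [LocallyCompactSpace X]
  [SecondCountableTopology X] [MeasurableSpace X] [BorelSpace X]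
  {κ : X → X → ℝ≥0∞} {μ ν ρ σ ω : Measure X} {A K S : Set X}

/-! ### Potentials and mutual energies -/

/-! Write `σ` for the inner balayage of `ω` onto `A`. Its potential equals `U^ω` `ν`-a.e. for every
`ν` of finite energy on `A`, so `I_f(ν) = ‖ν - σ‖² - ‖σ‖²` (`gaussFunctional_eq`): the Gauss problem
asks for the point nearest to `σ` in the convex set of unit measures. Uniqueness is strict
convexity; existence depends on whether mass can escape to infinity.

If `c_*(A) < ∞`, it cannot: unit measures of bounded energy are tight
(`exists_compact_measure_compl_le`), so the unit measures are strongly closed. If `σ(X) = 1`, the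
nearest point is `σ`. If `c_*(A) = ∞` and `σ(X) < 1`, the missing mass can be added to `σ` at
arbitrarily small energy, so the infimum of the distance is zero and is not attained. If `σ(X) > 1`,
project onto the measures of mass at most one, which always form a strongly closed set; the
projection has mass exactly one, since otherwise it could move closer to `σ`.

The balayage of a measure of finite energy is its projection onto the cone of measures on `A`. For
an admissible charge it is the strong limit of balayages onto compact subsets of `A`, whose energies
are bounded by Ugaheri's principle. The domination principle turns the variational inequalities into
equalities of potentials. -/

theorem IsKernel.measurable (hκ : IsKernel κ) : Measurable fun p : X × X => κ p.1 p.2 :=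
  hκ.lsc.measurable

theorem IsKernel.measurable_potential (hκ : IsKernel κ) (hν : ν ∈ radonCone X) :
    Measurable (potential κ ν) := by
  have : IsFiniteMeasureOnCompacts ν := hν
  exact hκ.measurable.lintegral_prod_right'

theorem IsKernel.mutualEnergy_eq (hκ : IsKernel κ) (hν : ν ∈ radonCone X) :
    mutualEnergy κ μ ν = ∫⁻ x, potential κ ν x ∂μ := by
  have : IsFiniteMeasureOnCompacts ν := hν
  exact lintegral_prod _ hκ.measurable.aemeasurable

theorem IsKernel.mutualEnergy_comm (hκ : IsKernel κ) (hμ : μ ∈ radonCone X)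
    (hν : ν ∈ radonCone X) : mutualEnergy κ μ ν = mutualEnergy κ ν μ := by
  have : IsFiniteMeasureOnCompacts ν := hν
  have : IsFiniteMeasureOnCompacts μ := hμ
  rw [hκ.mutualEnergy_eq hμ, mutualEnergy, lintegral_prod_symm _ hκ.measurable.aemeasurable]
  simp only [potential, hκ.symm]

theorem add_mem_radonCone (hμ : μ ∈ radonCone X) (hν : ν ∈ radonCone X) :
    μ + ν ∈ radonCone X := by
  refine ⟨fun K hK => ?_⟩
  have h1 : μ K < ∞ := hμ.lt_top_of_isCompact hK
  have h2 : ν K < ∞ := hν.lt_top_of_isCompact hK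
  simpa using ⟨h1, h2⟩

theorem smul_mem_radonCone (a : ℝ≥0) (hμ : μ ∈ radonCone X) : a • μ ∈ radonCone X := by
  refine ⟨fun K hK => ?_⟩
  have h1 : μ K < ∞ := hμ.lt_top_of_isCompact hK
  rw [Measure.smul_apply, ENNReal.smul_def, smul_eq_mul]
  exact ENNReal.mul_lt_top ENNReal.coe_lt_top h1

theorem mem_radonCone_of_le (hμ : μ ∈ radonCone X) (h : ν ≤ μ) : ν ∈ radonCone X :=
  ⟨fun _ hK => (h _).trans_lt (hμ.lt_top_of_isCompact hK)⟩

theorem mem_radonCone_of_finite (h : μ univ < ∞) : μ ∈ radonCone X :=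
  ⟨fun _ _ => (measure_mono (subset_univ _)).trans_lt h⟩

theorem IsKernel.mutualEnergy_mono (hκ : IsKernel κ) {μ' ν' : Measure X} (hμ : μ ∈ radonCone X)
    (hν : ν ∈ radonCone X) (h : μ' ≤ μ) (h' : ν' ≤ ν) :
    mutualEnergy κ μ' ν' ≤ mutualEnergy κ μ ν := by
  have hν' := mem_radonCone_of_le hν h'
  have hμ' := mem_radonCone_of_le hμ h
  calc mutualEnergy κ μ' ν' = ∫⁻ x, potential κ μ' x ∂ν' := by
        rw [hκ.mutualEnergy_comm hμ' hν', hκ.mutualEnergy_eq hμ']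
    _ ≤ ∫⁻ x, potential κ μ' x ∂ν := lintegral_mono' h' le_rfl
    _ = ∫⁻ x, potential κ ν x ∂μ' := by
        rw [← hκ.mutualEnergy_eq hμ', hκ.mutualEnergy_comm hν hμ', hκ.mutualEnergy_eq hν]
    _ ≤ mutualEnergy κ μ ν := by
        rw [hκ.mutualEnergy_eq hν]
        exact lintegral_mono' h le_rfl

theorem IsKernel.mutualEnergy_add_left (hκ : IsKernel κ) (hρ : ρ ∈ radonCone X) :
    mutualEnergy κ (μ + ν) ρ = mutualEnergy κ μ ρ + mutualEnergy κ ν ρ := by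
  simp only [hκ.mutualEnergy_eq hρ, lintegral_add_measure]

theorem IsKernel.mutualEnergy_smul_left (hκ : IsKernel κ) (hρ : ρ ∈ radonCone X) (a : ℝ≥0) :
    mutualEnergy κ (a • μ) ρ = a * mutualEnergy κ μ ρ := by
  simp only [hκ.mutualEnergy_eq hρ, lintegral_smul_measure, ENNReal.smul_def, smul_eq_mul]

/-- The potential of a Radon measure is lower semicontinuous. -/
theorem IsKernel.lowerSemicontinuous_potential (hκ : IsKernel κ) :
    LowerSemicontinuous (potential κ ν) := by
  rw [lowerSemicontinuous_iff_isClosed_preimage]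
  -- Second countability allows sublevel sets to be tested along sequences, where Fatou's lemma
  -- applies.
  refine fun c => IsSeqClosed.isClosed fun u x hu hx => ?_
  have hle : ∀ y, κ x y ≤ liminf (fun n => κ (u n) y) atTop := fun y =>
    (LowerSemicontinuousAt.le_liminf (f := fun z => κ z y)
      (hκ.lsc.comp (g := fun z : X => (z, y)) (by fun_prop) x)).trans
      (liminf_le_liminf_of_le (u := fun z => κ z y) hx)
  have hm : ∀ z, Measurable fun y => κ z y := fun z =>
    hκ.measurable.comp (measurable_prodMk_left (x := z))
  calc potential κ ν x ≤ ∫⁻ y, liminf (fun n => κ (u n) y) atTop ∂ν := lintegral_mono hle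
    _ ≤ liminf (fun n => potential κ ν (u n)) atTop := lintegral_liminf_le fun n => hm _
    _ ≤ c := by
      refine (liminf_le_liminf (v := fun _ => c) (Eventually.of_forall hu)).trans ?_
      simp

/-! ### The cones of measures of finite energy -/

/-- The inequality of the energy principle is stated in `[0, ∞]`, so it already bounds the mutual
energy. -/
theorem IsPerfectKernel.mutualEnergy_lt_top (hκ : IsPerfectKernel κ) (hμ : μ ∈ finiteEnergyCone κ)
    (hν : ν ∈ finiteEnergyCone κ) : mutualEnergy κ μ ν < ∞ := by
  have h := (hκ.energy_principle μ hμ ν hν).1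
  refine lt_of_le_of_lt (le_mul_of_one_le_left' (by norm_num)) (h.trans_lt ?_)
  exact ENNReal.add_lt_top.2 ⟨hμ.2, hν.2⟩

theorem IsPerfectKernel.add_mem (hκ : IsPerfectKernel κ) (hμ : μ ∈ finiteEnergyCone κ)
    (hν : ν ∈ finiteEnergyCone κ) : μ + ν ∈ finiteEnergyCone κ := by
  have hs := add_mem_radonCone hμ.1 hν.1
  refine ⟨hs, ?_⟩
  have h1 := hκ.toIsKernel.mutualEnergy_add_left (μ := μ) (ν := ν) hs
  rw [hκ.toIsKernel.mutualEnergy_comm hμ.1 hs, hκ.toIsKernel.mutualEnergy_comm hν.1 hs,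
    hκ.toIsKernel.mutualEnergy_add_left hμ.1, hκ.toIsKernel.mutualEnergy_add_left hν.1] at h1
  rw [energy, h1]
  simp only [ENNReal.add_lt_top]
  exact ⟨⟨hμ.2, hκ.mutualEnergy_lt_top hν hμ⟩, hκ.mutualEnergy_lt_top hμ hν, hν.2⟩

theorem IsKernel.energy_smul (hκ : IsKernel κ) (hμ : μ ∈ radonCone X) (a : ℝ≥0) :
    energy κ (a • μ) = a * (a * energy κ μ) := by
  have hs := smul_mem_radonCone a hμ
  rw [energy, hκ.mutualEnergy_smul_left hs, hκ.mutualEnergy_comm hμ hs,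
    hκ.mutualEnergy_smul_left hμ, energy]

theorem IsKernel.smul_mem (hκ : IsKernel κ) (a : ℝ≥0) (hμ : μ ∈ finiteEnergyCone κ) :
    a • μ ∈ finiteEnergyCone κ := by
  refine ⟨smul_mem_radonCone a hμ.1, ?_⟩
  rw [hκ.energy_smul hμ.1]
  exact ENNReal.mul_lt_top ENNReal.coe_lt_top (ENNReal.mul_lt_top ENNReal.coe_lt_top hμ.2)

theorem IsKernel.mem_of_le (hκ : IsKernel κ) (hμ : μ ∈ finiteEnergyCone κ) (h : ν ≤ μ) :
    ν ∈ finiteEnergyCone κ :=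
  ⟨mem_radonCone_of_le hμ.1 h, (hκ.mutualEnergy_mono hμ.1 hμ.1 h h).trans_lt hμ.2⟩

theorem zero_mem_finiteEnergyConeOn : (0 : Measure X) ∈ finiteEnergyConeOn κ A :=
  ⟨⟨mem_radonCone_of_finite (by simp), by simp [energy, mutualEnergy]⟩, by simp⟩

theorem IsPerfectKernel.add_memOn (hκ : IsPerfectKernel κ) (hμ : μ ∈ finiteEnergyConeOn κ A)
    (hν : ν ∈ finiteEnergyConeOn κ A) : μ + ν ∈ finiteEnergyConeOn κ A :=
  ⟨hκ.add_mem hμ.1 hν.1, by simp [hμ.2, hν.2]⟩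

theorem IsKernel.smul_memOn (hκ : IsKernel κ) (a : ℝ≥0) (hμ : μ ∈ finiteEnergyConeOn κ A) :
    a • μ ∈ finiteEnergyConeOn κ A :=
  ⟨hκ.smul_mem a hμ.1, by simp [hμ.2]⟩

theorem IsKernel.memOn_of_le (hκ : IsKernel κ) (hμ : μ ∈ finiteEnergyConeOn κ A) (h : ν ≤ μ) :
    ν ∈ finiteEnergyConeOn κ A :=
  ⟨hκ.mem_of_le hμ.1 h, le_antisymm ((h _).trans hμ.2.le) zero_le⟩

theorem finiteEnergyConeOn_mono {B : Set X} (h : A ⊆ B) (hμ : μ ∈ finiteEnergyConeOn κ A) :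
    μ ∈ finiteEnergyConeOn κ B :=
  ⟨hμ.1, measure_mono_null (compl_subset_compl.2 h) hμ.2⟩

/-! ### The strong pre-Hilbert structure -/

/-- The mutual energy as a real number. -/
def pairing (κ : X → X → ℝ≥0∞) (μ ν : Measure X) : ℝ := (mutualEnergy κ μ ν).toReal

/-- The square of the strong distance. -/
def sqDist (κ : X → X → ℝ≥0∞) (μ ν : Measure X) : ℝ :=
  pairing κ μ μ + pairing κ ν ν - 2 * pairing κ μ ν

theorem pairing_nonneg : 0 ≤ pairing κ μ ν := ENNReal.toReal_nonneg

theorem sqDist_self : sqDist κ μ μ = 0 := by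
  simp only [sqDist]; ring

theorem IsKernel.pairing_comm (hκ : IsKernel κ) (hμ : μ ∈ finiteEnergyCone κ)
    (hν : ν ∈ finiteEnergyCone κ) : pairing κ μ ν = pairing κ ν μ := by
  rw [pairing, hκ.mutualEnergy_comm hμ.1 hν.1, pairing]

theorem IsPerfectKernel.pairing_add_left (hκ : IsPerfectKernel κ) (hμ : μ ∈ finiteEnergyCone κ)
    (hν : ν ∈ finiteEnergyCone κ) (hρ : ρ ∈ finiteEnergyCone κ) :
    pairing κ (μ + ν) ρ = pairing κ μ ρ + pairing κ ν ρ := by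
  rw [pairing, hκ.toIsKernel.mutualEnergy_add_left hρ.1, ENNReal.toReal_add
    (hκ.mutualEnergy_lt_top hμ hρ).ne (hκ.mutualEnergy_lt_top hν hρ).ne, pairing, pairing]

theorem IsPerfectKernel.pairing_smul_left (hκ : IsPerfectKernel κ) (a : ℝ≥0)
    (hρ : ρ ∈ finiteEnergyCone κ) :
    pairing κ (a • μ) ρ = a * pairing κ μ ρ := by
  rw [pairing, hκ.toIsKernel.mutualEnergy_smul_left hρ.1, ENNReal.toReal_mul, pairing,
    ENNReal.coe_toReal]

theorem IsPerfectKernel.pairing_add_right (hκ : IsPerfectKernel κ) (hμ : μ ∈ finiteEnergyCone κ)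
    (hν : ν ∈ finiteEnergyCone κ) (hρ : ρ ∈ finiteEnergyCone κ) :
    pairing κ ρ (μ + ν) = pairing κ ρ μ + pairing κ ρ ν := by
  rw [hκ.toIsKernel.pairing_comm hρ (hκ.add_mem hμ hν), hκ.pairing_add_left hμ hν hρ,
    hκ.toIsKernel.pairing_comm hμ hρ, hκ.toIsKernel.pairing_comm hν hρ]

theorem IsPerfectKernel.pairing_smul_right (hκ : IsPerfectKernel κ) (a : ℝ≥0)
    (hμ : μ ∈ finiteEnergyCone κ) (hρ : ρ ∈ finiteEnergyCone κ) :
    pairing κ ρ (a • μ) = a * pairing κ ρ μ := by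
  rw [hκ.toIsKernel.pairing_comm hρ (hκ.toIsKernel.smul_mem a hμ), hκ.pairing_smul_left a hρ,
    hκ.toIsKernel.pairing_comm hμ hρ]

theorem IsPerfectKernel.sqDist_comm (hκ : IsPerfectKernel κ) (hμ : μ ∈ finiteEnergyCone κ)
    (hν : ν ∈ finiteEnergyCone κ) : sqDist κ μ ν = sqDist κ ν μ := by
  rw [sqDist, sqDist, hκ.toIsKernel.pairing_comm hμ hν]; ring

theorem IsPerfectKernel.sqDist_nonneg (hκ : IsPerfectKernel κ) (hμ : μ ∈ finiteEnergyCone κ)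
    (hν : ν ∈ finiteEnergyCone κ) : 0 ≤ sqDist κ μ ν := by
  have h := ENNReal.toReal_mono (ENNReal.add_lt_top.2 ⟨hμ.2, hν.2⟩).ne
    (hκ.energy_principle μ hμ ν hν).1
  rw [ENNReal.toReal_mul, ENNReal.toReal_add hμ.2.ne hν.2.ne, ENNReal.toReal_ofNat] at h
  simp only [energy] at h
  simp only [sqDist, pairing]
  linarith

theorem IsPerfectKernel.eq_of_sqDist_eq_zero (hκ : IsPerfectKernel κ)
    (hμ : μ ∈ finiteEnergyCone κ) (hν : ν ∈ finiteEnergyCone κ) (h : sqDist κ μ ν = 0) :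
    μ = ν := by
  refine (hκ.energy_principle μ hμ ν hν).2 ?_
  have h2 := hκ.mutualEnergy_lt_top hμ hν
  refine (ENNReal.toReal_eq_toReal_iff' (ENNReal.mul_lt_top (by norm_num) h2).ne
    (ENNReal.add_lt_top.2 ⟨hμ.2, hν.2⟩).ne).1 ?_
  rw [ENNReal.toReal_mul, ENNReal.toReal_add hμ.2.ne hν.2.ne, ENNReal.toReal_ofNat]
  simp only [sqDist, pairing] at h
  simp only [energy]
  linarith

/-- A quantitative form of the triangle inequality. -/
theorem IsPerfectKernel.sqDist_le (hκ : IsPerfectKernel κ) (hμ : μ ∈ finiteEnergyCone κ)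
    (hν : ν ∈ finiteEnergyCone κ) (hρ : ρ ∈ finiteEnergyCone κ) :
    sqDist κ μ ν ≤ 2 * sqDist κ μ ρ + 2 * sqDist κ ρ ν := by
  have hs := hκ.add_mem hμ hν
  have ht := hκ.add_mem hρ hρ
  -- This is `‖μ + ν - 2ρ‖² ≥ 0`, the term dropped from the parallelogram law for `μ - ρ` and `ν -
  -- ρ`.
  have h := hκ.sqDist_nonneg hs ht
  have e1 := hκ.toIsKernel.pairing_comm hμ hν
  have e2 := hκ.toIsKernel.pairing_comm hρ hν
  simp only [sqDist, hκ.pairing_add_left hμ hν hs, hκ.pairing_add_left hμ hν ht,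
    hκ.pairing_add_left hρ hρ ht, hκ.pairing_add_right hμ hν hμ, hκ.pairing_add_right hμ hν hν,
    hκ.pairing_add_right hρ hρ hμ, hκ.pairing_add_right hρ hρ hν,
    hκ.pairing_add_right hρ hρ hρ] at h
  simp only [sqDist]
  linarith

/-- The Cauchy-Schwarz inequality for `μ - ν` and `ρ`. -/
theorem IsPerfectKernel.sq_pairing_sub_le (hκ : IsPerfectKernel κ) (hμ : μ ∈ finiteEnergyCone κ)
    (hν : ν ∈ finiteEnergyCone κ) (hρ : ρ ∈ finiteEnergyCone κ) :
    (pairing κ μ ρ - pairing κ ν ρ) ^ 2 ≤ sqDist κ μ ν * pairing κ ρ ρ := by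
  -- This expands `‖μ + tρ - ν‖² ≥ 0`. Only `t ≥ 0` keeps `μ + tρ` positive; negative `t` is covered
  -- by exchanging `μ` and `ν`.
  have key : ∀ {μ ν : Measure X}, μ ∈ finiteEnergyCone κ → ν ∈ finiteEnergyCone κ → ∀ t : ℝ≥0,
      0 ≤ pairing κ ρ ρ * (t * t) + 2 * (pairing κ μ ρ - pairing κ ν ρ) * t + sqDist κ μ ν := by
    intro μ ν hμ hν t
    have hr := hκ.toIsKernel.smul_mem t hρ
    have hs := hκ.add_mem hμ hr
    have h := hκ.sqDist_nonneg hs hν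
    simp only [sqDist, hκ.pairing_add_left hμ hr hs, hκ.pairing_add_left hμ hr hν,
      hκ.pairing_add_right hμ hr hμ, hκ.pairing_add_right hμ hr hr,
      hκ.pairing_smul_left t hμ, hκ.pairing_smul_left t hr, hκ.pairing_smul_left t hν,
      hκ.pairing_smul_right t hρ hμ, hκ.pairing_smul_right t hρ hρ,
      hκ.toIsKernel.pairing_comm hρ hμ, hκ.toIsKernel.pairing_comm hρ hν] at h
    simp only [sqDist]
    linarith
  have h := discrim_le_zero (a := pairing κ ρ ρ) (b := 2 * (pairing κ μ ρ - pairing κ ν ρ))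
    (c := sqDist κ μ ν) fun t => ?_
  · rw [discrim] at h
    nlinarith
  rcases le_total 0 t with ht | ht
  · exact key hμ hν ⟨t, ht⟩
  · have := key hν hμ ⟨-t, by linarith⟩
    rw [hκ.sqDist_comm hν hμ] at this
    change 0 ≤ _ * (-t * -t) + _ * -t + _ at this
    linarith

/-- The parallelogram law. -/
theorem IsPerfectKernel.sqDist_eq_midpoint (hκ : IsPerfectKernel κ) (hμ : μ ∈ finiteEnergyCone κ)
    (hν : ν ∈ finiteEnergyCone κ) :
    sqDist κ μ ν = 2 * pairing κ μ μ + 2 * pairing κ ν ν -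
      4 * pairing κ ((2⁻¹ : ℝ≥0) • (μ + ν)) ((2⁻¹ : ℝ≥0) • (μ + ν)) := by
  have hs := hκ.add_mem hμ hν
  rw [hκ.pairing_smul_left _ (hκ.toIsKernel.smul_mem _ hs), hκ.pairing_smul_right _ hs hs,
    hκ.pairing_add_left hμ hν hs, hκ.pairing_add_right hμ hν hμ, hκ.pairing_add_right hμ hν hν,
    hκ.toIsKernel.pairing_comm hν hμ, sqDist]
  push_cast
  ring

/-! ### Strong convergence -/

theorem IsPerfectKernel.strongTendsto_iff (hκ : IsPerfectKernel κ) {u : ℕ → Measure X}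
    (hu : ∀ n, u n ∈ finiteEnergyCone κ) (hμ : μ ∈ finiteEnergyCone κ) :
    StrongTendsto κ u μ ↔ Tendsto (fun n => sqDist κ (u n) μ) atTop (𝓝 0) := by
  constructor
  · intro h
    have h2 := h.pow 2
    refine (h2.congr fun n => ?_).trans (by simp)
    exact Real.sq_sqrt (hκ.sqDist_nonneg (hu n) hμ)
  · intro h
    have := (Real.continuous_sqrt.tendsto _).comp h
    rw [Real.sqrt_zero] at this
    exact this

theorem IsPerfectKernel.tendsto_pairing (hκ : IsPerfectKernel κ) {u : ℕ → Measure X}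
    (hu : ∀ n, u n ∈ finiteEnergyCone κ) (hμ : μ ∈ finiteEnergyCone κ)
    (h : StrongTendsto κ u μ) (hρ : ρ ∈ finiteEnergyCone κ) :
    Tendsto (fun n => pairing κ (u n) ρ) atTop (𝓝 (pairing κ μ ρ)) := by
  rw [hκ.strongTendsto_iff hu hμ] at h
  have h2 : Tendsto (fun n => (pairing κ (u n) ρ - pairing κ μ ρ) ^ 2) atTop (𝓝 0) := by
    refine squeeze_zero (fun n => sq_nonneg _) (fun n => hκ.sq_pairing_sub_le (hu n) hμ hρ) ?_
    simpa using h.mul_const (pairing κ ρ ρ)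
  have h3 := (Real.continuous_sqrt.tendsto _).comp h2
  simp only [Function.comp_def, Real.sqrt_sq_eq_abs, Real.sqrt_zero] at h3
  exact tendsto_sub_nhds_zero_iff.1 ((tendsto_zero_iff_abs_tendsto_zero _).2 h3)

theorem IsPerfectKernel.tendsto_energy (hκ : IsPerfectKernel κ) {u : ℕ → Measure X}
    (hu : ∀ n, u n ∈ finiteEnergyCone κ) (hμ : μ ∈ finiteEnergyCone κ)
    (h : StrongTendsto κ u μ) :
    Tendsto (fun n => pairing κ (u n) (u n)) atTop (𝓝 (pairing κ μ μ)) := by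
  have h1 := hκ.tendsto_pairing hu hμ h hμ
  rw [hκ.strongTendsto_iff hu hμ] at h
  have := (h.add (h1.const_mul 2)).sub_const (pairing κ μ μ)
  refine (this.congr fun n => ?_).trans (le_of_eq (congrArg _ ?_))
  · simp only [sqDist]; ring
  · ring

/-- A sequence whose mutual squared distances are bounded by a null sequence converges. -/
theorem IsPerfectKernel.exists_strong_limit (hκ : IsPerfectKernel κ) {u : ℕ → Measure X}
    (hu : ∀ n, u n ∈ finiteEnergyCone κ) {b : ℕ → ℝ} (hb : Tendsto b atTop (𝓝 0))
    (h : ∀ m n, m ≤ n → sqDist κ (u m) (u n) ≤ b m + b n) :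
    ∃ ν ∈ finiteEnergyCone κ, StrongTendsto κ u ν := by
  refine hκ.consistency.complete u hu fun ε hε => ?_
  have hε2 : 0 < ε ^ 2 / 2 := by positivity
  obtain ⟨N, hN⟩ := eventually_atTop.1 (hb.eventually_lt_const hε2)
  refine ⟨N, fun m hm n hn => (Real.sqrt_lt' hε).2 ?_⟩
  change sqDist κ (u m) (u n) < ε ^ 2
  have h1 := hN m hm
  have h2 := hN n hn
  rcases le_total m n with hmn | hmn
  · linarith [h m n hmn]
  · rw [hκ.sqDist_comm (hu m) (hu n)]
    linarith [h n m hmn]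

/-! ### Inner capacity and properties that hold nearly everywhere -/

/-- The cone is stable under restriction to Borel sets, so the inequality between integrals
localizes. -/
theorem IsKernel.ae_le_of_forall_lintegral_le (hκ : IsKernel κ) {f g : X → ℝ≥0∞}
    (hf : Measurable f)
    (h : ∀ ν ∈ finiteEnergyConeOn κ A, ∫⁻ x, f x ∂ν ≤ ∫⁻ x, g x ∂ν)
    (hν : ν ∈ finiteEnergyConeOn κ A) : f ≤ᵐ[ν] g := by
  have : IsFiniteMeasureOnCompacts ν := hν.1.1
  exact ae_le_of_forall_setLIntegral_le_of_sigmaFinite hf fun s _ _ =>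
    h _ (hκ.memOn_of_le hν Measure.restrict_le_self)

theorem exists_unit_of_lt_innerCapacity {r : ℝ≥0∞} (h : r < innerCapacity κ A) :
    ∃ μ ∈ unitFiniteEnergyOn κ A, energy κ μ < r⁻¹ := by
  simp only [innerCapacity, lt_iSup_iff] at h
  obtain ⟨K, ⟨-, hKA⟩, h⟩ := h
  rw [ENNReal.lt_inv_iff_lt_inv] at h
  simp only [iInf_lt_iff] at h
  obtain ⟨μ, ⟨h1, h0⟩, hμ⟩ := h
  exact ⟨μ, ⟨⟨⟨mem_radonCone_of_finite (by simp [h1]), hμ.trans_le le_top⟩,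
    measure_mono_null (compl_subset_compl.2 hKA) h0⟩, h1⟩, hμ⟩

theorem inv_energy_le_innerCapacity (hK : IsCompact K) (hKA : K ⊆ A) (h1 : μ univ = 1)
    (h0 : μ Kᶜ = 0) : (energy κ μ)⁻¹ ≤ innerCapacity κ A := by
  refine le_trans (ENNReal.inv_le_inv.2 ?_) (le_iSup₂_of_le K ⟨hK, hKA⟩ le_rfl)
  exact iInf₂_le μ ⟨h1, h0⟩

/-- `A` need not be measurable: removing from `S` a measurable null hull of `Aᶜ` leaves a Borel
subset of `A ∩ S` of the same measure, to which inner regularity applies. -/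
theorem exists_isCompact_subset_of_lt_measure (hν : ν ∈ finiteEnergyConeOn κ A)
    (hS : MeasurableSet S) {r : ℝ≥0∞} (h : r < ν S) :
    ∃ K, IsCompact K ∧ K ⊆ A ∩ S ∧ r < ν K := by
  have : IsFiniteMeasureOnCompacts ν := hν.1.1
  have ht : ν (toMeasurable ν Aᶜ) = 0 := by rw [measure_toMeasurable, hν.2]
  rw [← measure_sdiff_null ht] at h
  obtain ⟨K, hK, hc, hr⟩ := (hS.diff (measurableSet_toMeasurable ν Aᶜ)).exists_lt_isCompact h
  refine ⟨K, hc, fun x hx => ⟨?_, (hK hx).1⟩, hr⟩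
  by_contra hxA
  exact (hK hx).2 (subset_toMeasurable ν _ hxA)

/-- The normalized restriction of a measure to a set. -/
def normalizedRestrict (ν : Measure X) (S : Set X) : Measure X :=
  (ν S).toNNReal⁻¹ • ν.restrict S

theorem normalizedRestrict_compl (hS : MeasurableSet S) : normalizedRestrict ν S Sᶜ = 0 := by
  simp [normalizedRestrict, Measure.restrict_apply hS.compl]

theorem IsKernel.normalizedRestrict_mem (hκ : IsKernel κ) (hν : ν ∈ finiteEnergyConeOn κ A)
    (h0 : ν S ≠ 0) (ht : ν S ≠ ∞) : normalizedRestrict ν S ∈ unitFiniteEnergyOn κ A := by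
  refine ⟨hκ.smul_memOn _ (hκ.memOn_of_le hν Measure.restrict_le_self), ?_⟩
  have : (ν S).toNNReal ≠ 0 := (ENNReal.toNNReal_pos h0 ht).ne'
  simp only [normalizedRestrict, Measure.smul_apply, Measure.restrict_apply_univ,
    ENNReal.smul_def, smul_eq_mul]
  rw [ENNReal.coe_inv this, ENNReal.coe_toNNReal ht, ENNReal.inv_mul_cancel h0 ht]

theorem IsPerfectKernel.pairing_normalizedRestrict_le (hκ : IsPerfectKernel κ)
    (hν : ν ∈ finiteEnergyCone κ) :
    pairing κ (normalizedRestrict ν S) (normalizedRestrict ν S) ≤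
      (ν S).toReal⁻¹ ^ 2 * pairing κ ν ν := by
  have hr := hκ.toIsKernel.mem_of_le hν (Measure.restrict_le_self (s := S))
  rw [normalizedRestrict, hκ.pairing_smul_left _ (hκ.toIsKernel.smul_mem _ hr),
    hκ.pairing_smul_right _ hr hr, ← mul_assoc, NNReal.coe_inv, ← ENNReal.toReal, ← pow_two]
  refine mul_le_mul_of_nonneg_left (ENNReal.toReal_mono hν.2.ne ?_) (by positivity)
  exact hκ.toIsKernel.mutualEnergy_mono hν.1 hν.1 Measure.restrict_le_self Measure.restrict_le_self

/-- A Borel property holds nearly everywhere on `A` if and only if it holds almost everywhere with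
respect to all measures of finite energy concentrated on `A`. -/
theorem IsKernel.nearlyEverywhereOn_iff (hκ : IsKernel κ) {P : X → Prop}
    (hP : MeasurableSet {x | P x}) :
    NearlyEverywhereOn κ A P ↔ ∀ ν ∈ finiteEnergyConeOn κ A, ∀ᵐ x ∂ν, P x := by
  constructor
  · intro h ν hν
    by_contra hpos
    -- Normalizing `ν` on a compact piece of the exceptional set gives a unit measure of finite
    -- energy there, so its capacity would be positive.
    obtain ⟨K, hK, hKA, hKpos⟩ :=
      exists_isCompact_subset_of_lt_measure hν hP.compl (pos_iff_ne_zero.2 hpos)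
    have : IsFiniteMeasureOnCompacts ν := hν.1.1
    have hm := hκ.normalizedRestrict_mem hν hKpos.ne' hK.measure_lt_top.ne
    have := inv_energy_le_innerCapacity (κ := κ) hK (A := {x | x ∈ A ∧ ¬ P x}) hKA hm.2
      (normalizedRestrict_compl hK.measurableSet)
    rw [h, nonpos_iff_eq_zero, ENNReal.inv_eq_zero] at this
    exact hm.1.1.2.ne this
  · intro h
    by_contra hne
    obtain ⟨μ, hμ, -⟩ := exists_unit_of_lt_innerCapacity (pos_iff_ne_zero.2 hne)
    have h1 := h μ (finiteEnergyConeOn_mono (fun x hx => hx.1) hμ.1)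
    have h2 : μ {x | x ∈ A ∧ ¬ P x} = 0 := measure_mono_null (fun x hx => hx.2) h1
    have h3 := hμ.2
    rw [← union_compl_self {x | x ∈ A ∧ ¬ P x}, measure_union_null h2 hμ.1.2] at h3
    exact zero_ne_one h3

/-- On a set of finite inner capacity, the energies of unit measures are bounded from below. -/
theorem IsPerfectKernel.exists_pos_le_energy (hκ : IsPerfectKernel κ)
    (hA : innerCapacity κ A < ∞) :
    ∃ δ : ℝ, 0 < δ ∧ ∀ ν ∈ unitFiniteEnergyOn κ A, δ ≤ pairing κ ν ν := by
  -- A compact `K` with `ν K > 1/2` costs a factor `4` in the energy after normalization; the `+ 1`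
  -- keeps the inverse meaningful if the capacity vanishes.
  refine ⟨((innerCapacity κ A).toReal + 1)⁻¹ / 4, by positivity, fun ν hν => ?_⟩
  obtain ⟨K, hK, hKA, hKν⟩ := exists_isCompact_subset_of_lt_measure (S := univ) hν.1 .univ
    (r := 2⁻¹) (by rw [hν.2]; simp)
  have : IsFiniteMeasureOnCompacts ν := hν.1.1.1
  have hfin : ν K ≠ ∞ := hK.measure_lt_top.ne
  have hm := hκ.toIsKernel.normalizedRestrict_mem hν.1 (ne_bot_of_gt hKν) hfin
  have h1 := inv_energy_le_innerCapacity (κ := κ) hK (hKA.trans inter_subset_left) hm.2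
    (normalizedRestrict_compl hK.measurableSet)
  have h2 := hκ.pairing_normalizedRestrict_le hν.1.1 (S := K)
  have h3 : 2⁻¹ ≤ (ν K).toReal := by
    have := ENNReal.toReal_mono hfin hKν.le
    simpa using this
  have h4 := ENNReal.toReal_mono hA.ne h1
  rw [ENNReal.toReal_inv] at h4
  change (pairing κ (normalizedRestrict ν K) (normalizedRestrict ν K))⁻¹ ≤ _ at h4
  set e := pairing κ (normalizedRestrict ν K) (normalizedRestrict ν K)
  have he : 0 < e := by
    refine lt_of_le_of_ne pairing_nonneg fun h0 => ?_
    have : innerCapacity κ A = ∞ := by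
      rw [← top_le_iff]
      refine le_trans (le_of_eq ?_) h1
      rw [eq_comm, ENNReal.inv_eq_top]
      exact ((ENNReal.toReal_eq_zero_iff _).1 h0.symm).resolve_right hm.1.1.2.ne
    exact hA.ne this
  have h5 : ((innerCapacity κ A).toReal + 1)⁻¹ ≤ e := by
    rw [inv_le_comm₀ (by positivity) he]
    linarith
  have h6 : (ν K).toReal⁻¹ ^ 2 ≤ 4 := by
    have : (ν K).toReal⁻¹ ≤ 2 := by
      rw [inv_le_comm₀ (by linarith) (by norm_num)]
      linarith
    nlinarith [inv_nonneg.2 (ENNReal.toReal_nonneg (a := ν K))]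
  have h7 := mul_le_mul_of_nonneg_right h6 (pairing_nonneg (κ := κ) (μ := ν) (ν := ν))
  linarith

/-! ### Vague convergence -/

theorem le_ofReal_integral (hμ : μ ∈ radonCone X) {φ : X → ℝ} (hφ : Continuous φ)
    (hc : HasCompactSupport φ) (h0 : ∀ x, 0 ≤ φ x) (hK : MeasurableSet K) (h1 : ∀ x ∈ K, 1 ≤ φ x) :
    μ K ≤ ENNReal.ofReal (∫ x, φ x ∂μ) := by
  have : IsFiniteMeasureOnCompacts μ := hμ
  rw [ofReal_integral_eq_lintegral_ofReal (hφ.integrable_of_hasCompactSupport hc)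
    (Eventually.of_forall h0), ← lintegral_indicator_one hK]
  refine lintegral_mono fun x => ?_
  by_cases hx : x ∈ K
  · simpa [hx] using h1 x hx
  · simp [hx]

theorem ofReal_integral_le (hμ : μ ∈ radonCone X) {φ : X → ℝ} (hφ : Continuous φ)
    (hc : HasCompactSupport φ) (h0 : ∀ x, φ x ∈ Icc (0 : ℝ) 1) (hS : MeasurableSet S)
    (hφS : tsupport φ ⊆ S) : ENNReal.ofReal (∫ x, φ x ∂μ) ≤ μ S := by
  have : IsFiniteMeasureOnCompacts μ := hμ
  rw [ofReal_integral_eq_lintegral_ofReal (hφ.integrable_of_hasCompactSupport hc)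
    (Eventually.of_forall fun x => (h0 x).1), ← lintegral_indicator_one hS]
  refine lintegral_mono fun x => ?_
  by_cases hx : x ∈ S
  · simpa [hx] using (h0 x).2
  · simp [image_eq_zero_of_notMem_tsupport fun h => hx (hφS h)]

/-- Urysohn functions between a compact subset of `U` and `U` compare the masses. For `U = X`, mass
cannot grow in the limit; for `c = 0`, null open sets stay null. -/
theorem VagueTendsto.measure_le_of_isOpen {u : ℕ → Measure X} (hu : ∀ n, u n ∈ radonCone X)
    (hμ : μ ∈ radonCone X) (h : VagueTendsto u μ) {U : Set X} (hU : IsOpen U) {c : ℝ≥0∞}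
    (hc : ∀ᶠ n in atTop, u n U ≤ c) : μ U ≤ c := by
  have : IsFiniteMeasureOnCompacts μ := hμ
  rw [hU.measure_eq_iSup_isCompact]
  refine iSup₂_le fun K hKU => iSup_le fun hK => ?_
  obtain ⟨φ, h1, hsupp, hsub, h0⟩ := exists_continuousMap_one_of_isCompact_subset_isOpen hK hU hKU
  refine (le_ofReal_integral hμ φ.continuous hsupp (fun x => (h0 x).1) hK.measurableSet
    fun x hx => (h1 hx).ge).trans ?_
  have := (ENNReal.continuous_ofReal.tendsto _).comp (h φ φ.continuous hsupp)
  refine le_of_tendsto this (hc.mono fun n hn => ?_)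
  exact (ofReal_integral_le (hu n) φ.continuous hsupp h0 hU.measurableSet hsub).trans hn

/-! ### Minimization of quadratic functionals -/

/-- The Hilbert space projection argument. For `Q(μ) = ‖μ‖² - 2L(μ)` with `L` affine at midpoints,
`‖μ - ν‖² = 2Q(μ) + 2Q(ν) - 4Q((μ + ν)/2)`, so minimizing sequences are strongly Cauchy. -/
theorem IsPerfectKernel.exists_minimizer (hκ : IsPerfectKernel κ) {C : Set (Measure X)}
    (hC : C ⊆ finiteEnergyCone κ) (hne : C.Nonempty)
    (hmid : ∀ μ ∈ C, ∀ ν ∈ C, (2⁻¹ : ℝ≥0) • (μ + ν) ∈ C)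
    (hclosed : ∀ u : ℕ → Measure X, (∀ n, u n ∈ C) → ∀ ν ∈ finiteEnergyCone κ,
      StrongTendsto κ u ν → ν ∈ C)
    {L : Measure X → ℝ} (hL : ∀ μ ∈ C, ∀ ν ∈ C, L ((2⁻¹ : ℝ≥0) • (μ + ν)) = (L μ + L ν) / 2)
    (hLc : ∀ u : ℕ → Measure X, (∀ n, u n ∈ C) → ∀ ν ∈ C, StrongTendsto κ u ν →
      Tendsto (fun n => L (u n)) atTop (𝓝 (L ν)))
    {b : ℝ} (hb : ∀ μ ∈ C, b ≤ pairing κ μ μ - 2 * L μ) :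
    ∃ μ ∈ C, ∀ ν ∈ C, pairing κ μ μ - 2 * L μ ≤ pairing κ ν ν - 2 * L ν := by
  set Q : Measure X → ℝ := fun μ => pairing κ μ μ - 2 * L μ with hQ
  have hbdd : BddBelow (Q '' C) := ⟨b, by rintro _ ⟨μ, hμ, rfl⟩; exact hb μ hμ⟩
  have hinf : ∀ μ ∈ C, sInf (Q '' C) ≤ Q μ := fun μ hμ => csInf_le hbdd ⟨μ, hμ, rfl⟩
  have hex : ∀ n : ℕ, ∃ μ ∈ C, Q μ < sInf (Q '' C) + 1 / ((n : ℝ) + 1) := fun n => by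
    obtain ⟨_, ⟨μ, hμ, rfl⟩, h⟩ := exists_lt_of_csInf_lt (hne.image Q)
      (lt_add_of_pos_right (sInf (Q '' C)) (Nat.one_div_pos_of_nat (n := n)))
    exact ⟨μ, hμ, h⟩
  choose u hu hQu using hex
  have hlim : Tendsto (fun n : ℕ => 1 / ((n : ℝ) + 1)) atTop (𝓝 0) :=
    tendsto_one_div_add_atTop_nhds_zero_nat
  obtain ⟨μ, hμ, hconv⟩ := hκ.exists_strong_limit (fun n => hC (hu n))
    (b := fun n => 2 * (1 / ((n : ℝ) + 1))) (by simpa using hlim.const_mul 2) fun m n _ => by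
      have h1 := hinf _ (hmid _ (hu m) _ (hu n))
      have h2 := hQu m
      have h3 := hQu n
      rw [hκ.sqDist_eq_midpoint (hC (hu m)) (hC (hu n))]
      simp only [hQ, hL _ (hu m) _ (hu n)] at h1 h2 h3 ⊢
      linarith
  have hμC := hclosed u hu μ hμ hconv
  refine ⟨μ, hμC, fun ν hν => ?_⟩
  have hQt : Tendsto (fun n => Q (u n)) atTop (𝓝 (Q μ)) :=
    (hκ.tendsto_energy (fun n => hC (hu n)) hμ hconv).sub
      ((hLc u hu μ hμC hconv).const_mul 2)
  have hle : Q μ ≤ sInf (Q '' C) := by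
    refine le_of_tendsto_of_tendsto' hQt ?_ fun n => (hQu n).le
    simpa using hlim.const_add (sInf (Q '' C))
  exact hle.trans (hinf ν hν)

/-- First-order condition at a minimizer: divide by `t` and let `t` decrease to `0`. -/
theorem nonneg_of_forall_quadratic {x y : ℝ}
    (h : ∀ t : ℝ, 0 < t → t ≤ 1 → 0 ≤ 2 * t * x + t ^ 2 * y) : 0 ≤ x := by
  have hev : ∀ᶠ t : ℝ in 𝓝[>] 0, 0 ≤ 2 * x + t * y := by
    filter_upwards [Ioc_mem_nhdsGT zero_lt_one] with t ht
    have := h t ht.1 ht.2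
    have h2 : 0 ≤ t * (2 * x + t * y) := by linarith
    exact nonneg_of_mul_nonneg_right h2 ht.1
  have hlim : Tendsto (fun t : ℝ => 2 * x + t * y) (𝓝[>] 0) (𝓝 (2 * x + 0 * y)) :=
    ((continuous_const.add (continuous_id.mul continuous_const)).tendsto 0).mono_left
      nhdsWithin_le_nhds
  have := ge_of_tendsto hlim hev
  linarith

/-- Minimization over the cone of measures concentrated on `A`, with the variational inequality
and the complementarity relation. -/
theorem IsPerfectKernel.exists_cone_minimizer (hκ : IsPerfectKernel κ)
    (hA : IsStronglyClosedOn κ A) {L : Measure X → ℝ}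
    (hadd : ∀ μ ∈ finiteEnergyConeOn κ A, ∀ ν ∈ finiteEnergyConeOn κ A, L (μ + ν) = L μ + L ν)
    (hsmul : ∀ a : ℝ≥0, ∀ μ ∈ finiteEnergyConeOn κ A, L (a • μ) = a * L μ)
    (hLc : ∀ u : ℕ → Measure X, (∀ n, u n ∈ finiteEnergyConeOn κ A) →
      ∀ ν ∈ finiteEnergyConeOn κ A, StrongTendsto κ u ν →
      Tendsto (fun n => L (u n)) atTop (𝓝 (L ν)))
    {b : ℝ} (hb : ∀ μ ∈ finiteEnergyConeOn κ A, b ≤ pairing κ μ μ - 2 * L μ) :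
    ∃ μ ∈ finiteEnergyConeOn κ A, (∀ ν ∈ finiteEnergyConeOn κ A, L ν ≤ pairing κ μ ν) ∧
      L μ = pairing κ μ μ := by
  have hk := hκ.toIsKernel
  obtain ⟨μ, hμ, hmin⟩ := hκ.exists_minimizer (C := finiteEnergyConeOn κ A) (fun μ h => h.1)
    ⟨0, zero_mem_finiteEnergyConeOn⟩
    (fun μ hμ ν hν => hk.smul_memOn _ (hκ.add_memOn hμ hν)) hA
    (fun μ hμ ν hν => by
      rw [hsmul _ _ (hκ.add_memOn hμ hν), hadd μ hμ ν hν]; push_cast; ring) hLc hb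
  have key : ∀ ν ∈ finiteEnergyConeOn κ A, L ν ≤ pairing κ μ ν := fun ν hν => by
    refine sub_nonneg.1 (nonneg_of_forall_quadratic (y := pairing κ ν ν) fun t ht _ => ?_)
    lift t to ℝ≥0 using ht.le
    have ht := hk.smul_memOn t hν
    have hs := hκ.add_memOn hμ ht
    have h := hmin _ hs
    rw [hadd _ hμ _ ht, hsmul t ν hν, hκ.pairing_add_left hμ.1 ht.1 hs.1,
      hκ.pairing_smul_left t hs.1, hκ.pairing_add_right hμ.1 ht.1 hμ.1,
      hκ.pairing_add_right hμ.1 ht.1 hν.1, hκ.pairing_smul_right t hν.1 hμ.1,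
      hκ.pairing_smul_right t hν.1 hν.1, hk.pairing_comm hν.1 hμ.1] at h
    linarith
  refine ⟨μ, hμ, key, le_antisymm (key μ hμ) ?_⟩
  -- The competitor `(1 - t)μ` stays in the cone for `t ≤ 1` and gives the reverse inequality.
  refine sub_nonneg.1 (nonneg_of_forall_quadratic (y := pairing κ μ μ) fun t ht ht1 => ?_)
  obtain ⟨a, ha⟩ : ∃ a : ℝ≥0, (a : ℝ) = 1 - t := ⟨⟨1 - t, by linarith⟩, rfl⟩
  have h := hmin _ (hk.smul_memOn a hμ)
  rw [hsmul _ μ hμ, hκ.pairing_smul_left _ (hk.smul_mem _ hμ.1),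
    hκ.pairing_smul_right _ hμ.1 hμ.1, ha] at h
  linarith

/-- The variational inequality and the complementarity relation in terms of potentials. -/
theorem IsKernel.potential_of_lintegral_le (hκ : IsKernel κ) {g : X → ℝ≥0∞} (hg : Measurable g)
    (hμ : μ ∈ finiteEnergyConeOn κ A)
    (h : ∀ ν ∈ finiteEnergyConeOn κ A, ∫⁻ x, g x ∂ν ≤ ∫⁻ x, potential κ μ x ∂ν)
    (heq : ∫⁻ x, potential κ μ x ∂μ ≤ ∫⁻ x, g x ∂μ) :
    (∀ ν ∈ finiteEnergyConeOn κ A, g ≤ᵐ[ν] potential κ μ) ∧ g =ᵐ[μ] potential κ μ := by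
  have h1 : ∀ ν ∈ finiteEnergyConeOn κ A, g ≤ᵐ[ν] potential κ μ := fun ν hν =>
    hκ.ae_le_of_forall_lintegral_le hg h hν
  refine ⟨h1, ae_eq_of_ae_le_of_lintegral_le (h1 μ hμ) (ne_top_of_le_ne_top ?_ (h μ hμ))
    (hκ.measurable_potential hμ.1.1).aemeasurable heq⟩
  rw [← hκ.mutualEnergy_eq hμ.1.1]
  exact hμ.1.2.ne

/-! ### Measures on compact sets -/

theorem IsPerfectKernel.isStronglyClosedOn_of_isClosed (hκ : IsPerfectKernel κ) (hA : IsClosed A) :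
    IsStronglyClosedOn κ A := fun u hu ν hν h =>
  ⟨hν, nonpos_iff_eq_zero.1 <| (hκ.consistency.finer u (fun n => (hu n).1) ν hν h
    ).measure_le_of_isOpen (fun n => (hu n).1.1) hν.1 hA.isOpen_compl
      (Eventually.of_forall fun n => (hu n).2.le)⟩

/-- Otherwise some unit measures on `K` would have energies tending to zero; they would converge
strongly, hence vaguely, to zero, which is impossible for mass one on a fixed compact set. -/
theorem IsPerfectKernel.exists_sq_measure_le (hκ : IsPerfectKernel κ) (hK : IsCompact K) :
    ∃ c : ℝ, 0 < c ∧ ∀ μ ∈ finiteEnergyCone κ, (μ K).toReal ^ 2 ≤ c * pairing κ μ μ := by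
  have hk := hκ.toIsKernel
  by_contra! hcon
  choose v hv hlt using fun n : ℕ => hcon ((n : ℝ) + 1) (by positivity)
  have hvK : ∀ n, v n K ≠ 0 := fun n h => by
    have := hlt n
    rw [h, ENNReal.toReal_zero, zero_pow two_ne_zero] at this
    exact absurd this (not_lt.2 (mul_nonneg (by positivity) pairing_nonneg))
  have hvK' : ∀ n, v n K ≠ ∞ := fun n => by
    have : IsFiniteMeasureOnCompacts (v n) := (hv n).1
    exact hK.measure_lt_top.ne
  set u : ℕ → Measure X := fun n => normalizedRestrict (v n) K with hu_def
  have hu : ∀ n, u n ∈ unitFiniteEnergyOn κ univ := fun n =>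
    hk.normalizedRestrict_mem ⟨hv n, by simp⟩ (hvK n) (hvK' n)
  have hz : (0 : Measure X) ∈ finiteEnergyCone κ := (zero_mem_finiteEnergyConeOn (A := univ)).1
  have hstrong : StrongTendsto κ u 0 := by
    rw [hκ.strongTendsto_iff (fun n => (hu n).1.1) hz]
    refine squeeze_zero (fun n => hκ.sqDist_nonneg (hu n).1.1 hz) (fun n => ?_)
      (tendsto_one_div_add_atTop_nhds_zero_nat (𝕜 := ℝ))
    have h0 : ∀ μ : Measure X, pairing κ μ 0 = 0 := fun μ => by simp [pairing, mutualEnergy]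
    have h1 := hκ.pairing_normalizedRestrict_le (hv n) (S := K)
    have hpos := ENNReal.toReal_pos (hvK n) (hvK' n)
    rw [sqDist, h0, h0, mul_zero, sub_zero, add_zero]
    refine h1.trans ?_
    rw [inv_pow, ← div_eq_inv_mul, div_le_div_iff₀ (by positivity) (by positivity)]
    linarith [hlt n]
  obtain ⟨φ, h1, -, hsupp, h0⟩ := exists_continuous_one_zero_of_isCompact hK isClosed_empty
    (disjoint_empty K)
  have hvague := hκ.consistency.finer u (fun n => (hu n).1.1) 0 hz hstrong φ φ.continuous hsupp
  have := (ENNReal.continuous_ofReal.tendsto _).comp hvague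
  have hge : (1 : ℝ≥0∞) ≤ ENNReal.ofReal (∫ x, φ x ∂(0 : Measure X)) := by
    refine ge_of_tendsto' this fun n => ?_
    refine le_trans ?_ (le_ofReal_integral (hu n).1.1.1 φ.continuous hsupp (fun x => (h0 x).1)
      hK.measurableSet fun x hx => (h1 hx).ge)
    have h2 := (hu n).2
    rw [← union_compl_self K] at h2
    exact h2.ge.trans ((measure_union_le _ _).trans
      (by rw [normalizedRestrict_compl hK.measurableSet, add_zero]))
  simp at hge

theorem exists_hasCompactSupport_extension (hK : IsCompact K) {g : X → ℝ} (hg : ContinuousOn g K) :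
    ∃ φ : X → ℝ, Continuous φ ∧ HasCompactSupport φ ∧ EqOn φ g K := by
  obtain ⟨G, hG⟩ := ContinuousMap.exists_restrict_eq hK.isClosed (Y := ℝ)
    ⟨K.domRestrict g, hg.domRestrict⟩
  obtain ⟨χ, h1, -, hsupp, -⟩ := exists_continuous_one_zero_of_isCompact hK isClosed_empty
    (disjoint_empty K)
  refine ⟨fun x => χ x * G x, χ.continuous.mul G.continuous, hsupp.mul_right, fun x hx => ?_⟩
  have h2 : G x = g x := congrArg (fun f : C(K, ℝ) => f ⟨x, hx⟩) hG
  simp [h1 hx, h2]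

/-- A bounded continuous function on a compact set `K` is dominated nearly everywhere on `K` by the
potential of a measure on `K`, with equality almost everywhere with respect to that measure. -/
theorem IsPerfectKernel.exists_potential_ge (hκ : IsPerfectKernel κ) (hK : IsCompact K)
    {g : X → ℝ≥0∞} (hgm : Measurable g) (hgc : ContinuousOn g K) {m : ℝ≥0}
    (hm : ∀ x ∈ K, g x ≤ m) :
    ∃ μ ∈ finiteEnergyConeOn κ K, (∀ ν ∈ finiteEnergyConeOn κ K, g ≤ᵐ[ν] potential κ μ) ∧
      g =ᵐ[μ] potential κ μ := by
  have hk := hκ.toIsKernel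
  have hfin : ∀ x ∈ K, g x ≠ ∞ := fun x hx => ((hm x hx).trans_lt ENNReal.coe_lt_top).ne
  -- On measures concentrated on `K`, integrating `g` is integrating `φ`, a vaguely and hence
  -- strongly continuous functional.
  obtain ⟨φ, hφ, hsupp, hφg⟩ := exists_hasCompactSupport_extension hK
    (ENNReal.continuousOn_toReal.comp hgc hfin)
  have hint : ∀ ν ∈ radonCone X, Integrable φ ν := fun ν hν => by
    have : IsFiniteMeasureOnCompacts ν := hν
    exact hφ.integrable_of_hasCompactSupport hsupp
  have hgφ : ∀ ν ∈ finiteEnergyConeOn κ K, ∫⁻ x, g x ∂ν = ENNReal.ofReal (∫ x, φ x ∂ν) := by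
    intro ν hν
    have hae : ∀ᵐ x ∂ν, x ∈ K := hν.2
    rw [ofReal_integral_eq_lintegral_ofReal (hint ν hν.1.1)
      (hae.mono fun x hx => by rw [hφg hx]; exact ENNReal.toReal_nonneg)]
    refine lintegral_congr_ae (hae.mono fun x hx => ?_)
    simp only [hφg hx, Function.comp, ENNReal.ofReal_toReal (hfin x hx)]
  have hL0 : ∀ ν ∈ finiteEnergyConeOn κ K, 0 ≤ ∫ x, φ x ∂ν := fun ν hν => by
    have hae : ∀ᵐ x ∂ν, x ∈ K := hν.2
    exact integral_nonneg_of_ae (hae.mono fun x hx => by rw [hφg hx]; exact ENNReal.toReal_nonneg)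
  obtain ⟨c, hc, hmass⟩ := hκ.exists_sq_measure_le hK
  obtain ⟨μ, hμ, hle, heq⟩ := hκ.exists_cone_minimizer (A := K) (L := fun ν => ∫ x, φ x ∂ν)
    (b := -(c * m ^ 2)) (hκ.isStronglyClosedOn_of_isClosed hK.isClosed)
    (fun μ hμ ν hν => integral_add_measure (hint μ hμ.1.1) (hint ν hν.1.1))
    (fun a μ hμ => by simp [integral_smul_nnreal_measure, NNReal.smul_def])
    (fun u hu ν hν h => hκ.consistency.finer u (fun n => (hu n).1) ν hν.1 h φ hφ hsupp)
    (fun ν hν => by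
      have hae : ∀ᵐ x ∂ν, x ∈ K := hν.2
      have : IsFiniteMeasureOnCompacts ν := hν.1.1
      have h1 : ∫⁻ x, g x ∂ν ≤ m * ν K := by
        refine (lintegral_mono_ae (g := K.indicator fun _ => (m : ℝ≥0∞))
          (hae.mono fun x hx => ?_)).trans ?_
        · simpa [hx] using hm x hx
        · rw [lintegral_indicator_const hK.measurableSet]
      rw [hgφ ν hν] at h1
      have h2 := ENNReal.toReal_mono
        (ENNReal.mul_lt_top ENNReal.coe_lt_top hK.measure_lt_top).ne h1
      rw [ENNReal.toReal_ofReal (hL0 ν hν), ENNReal.toReal_mul, ENNReal.coe_toReal] at h2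
      have h3 := hmass ν hν.1
      -- Completing the square: `c * I(ν) ≥ ν(K)²`, so the product is at least `(ν(K) - c * m)²`.
      have h4 : 0 ≤ c * (pairing κ ν ν - 2 * (m * (ν K).toReal) + c * m ^ 2) := by
        nlinarith [sq_nonneg ((ν K).toReal - c * m)]
      have h5 := nonneg_of_mul_nonneg_right h4 hc
      linarith)
  have hpot : ∀ ν ∈ finiteEnergyConeOn κ K,
      ∫⁻ x, potential κ μ x ∂ν = ENNReal.ofReal (pairing κ μ ν) := fun ν hν => by
    rw [← hk.mutualEnergy_eq hμ.1.1, hk.pairing_comm hμ.1 hν.1, pairing,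
      ENNReal.ofReal_toReal (hκ.mutualEnergy_lt_top hν.1 hμ.1).ne]
  refine ⟨μ, hμ, hk.potential_of_lintegral_le hgm hμ (fun ν hν => ?_) ?_⟩
  · rw [hgφ ν hν, hpot ν hν]
    exact ENNReal.ofReal_le_ofReal (hle ν hν)
  · rw [hgφ μ hμ, hpot μ hμ, ← heq]

/-! ### Inner balayage -/

theorem IsKernel.isInnerBalayage_iff (hκ : IsKernel κ) (hω : ω ∈ radonCone X) :
    IsInnerBalayage κ A ω σ ↔ σ ∈ finiteEnergyConeOn κ A ∧
      ∀ ν ∈ finiteEnergyConeOn κ A, potential κ σ =ᵐ[ν] potential κ ω := by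
  constructor
  · intro h
    refine ⟨h.mem, (hκ.nearlyEverywhereOn_iff ?_).1 h.potential_eq⟩
    exact measurableSet_eq_fun (hκ.measurable_potential h.mem.1.1) (hκ.measurable_potential hω)
  · rintro ⟨h1, h2⟩
    refine ⟨h1, (hκ.nearlyEverywhereOn_iff ?_).2 h2⟩
    exact measurableSet_eq_fun (hκ.measurable_potential h1.1.1) (hκ.measurable_potential hω)

theorem IsKernel.lintegral_potential_comm (hκ : IsKernel κ) (hμ : μ ∈ radonCone X)
    (hν : ν ∈ radonCone X) : ∫⁻ x, potential κ μ x ∂ν = ∫⁻ x, potential κ ν x ∂μ := by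
  rw [← hκ.mutualEnergy_eq hμ, ← hκ.mutualEnergy_eq hν, hκ.mutualEnergy_comm hν hμ]

/-- Both potentials agree a.e. for `μ` and for `ν`, as both measures live on `A`; hence `‖μ - ν‖² =
0`. -/
theorem IsPerfectKernel.eq_of_isInnerBalayage (hκ : IsPerfectKernel κ) (hω : ω ∈ radonCone X)
    (hμ : IsInnerBalayage κ A ω μ) (hν : IsInnerBalayage κ A ω ν) : μ = ν := by
  have hk := hκ.toIsKernel
  rw [hk.isInnerBalayage_iff hω] at hμ hν
  obtain ⟨hμ, hμω⟩ := hμ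
  obtain ⟨hν, hνω⟩ := hν
  refine hκ.eq_of_sqDist_eq_zero hμ.1 hν.1 ?_
  have h1 : pairing κ μ μ = pairing κ μ ν := by
    rw [pairing, pairing, hk.mutualEnergy_eq hμ.1.1, hk.mutualEnergy_eq hν.1.1,
      lintegral_congr_ae ((hμω μ hμ).trans (hνω μ hμ).symm)]
  have h2 : pairing κ ν ν = pairing κ μ ν := by
    rw [hk.pairing_comm hμ.1 hν.1, pairing, pairing, hk.mutualEnergy_eq hμ.1.1,
      hk.mutualEnergy_eq hν.1.1, lintegral_congr_ae ((hμω ν hν).trans (hνω ν hν).symm)]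
  rw [sqDist, h1, h2]
  ring

/-- Under the domination principle, a measure on `A` whose potential dominates that of `ω` nearly
everywhere on `A` and coincides with it almost everywhere is the inner balayage of `ω`. -/
theorem potential_eq_of_domination (hdom : DominationPrinciple κ)
    (hω : ω ∈ radonCone X) (hμ : μ ∈ finiteEnergyConeOn κ A)
    (h : ∀ ν ∈ finiteEnergyConeOn κ A, potential κ ω ≤ᵐ[ν] potential κ μ)
    (heq : potential κ ω =ᵐ[μ] potential κ μ) :
    (∀ x, potential κ μ x ≤ potential κ ω x) ∧
      ∀ ν ∈ finiteEnergyConeOn κ A, potential κ μ =ᵐ[ν] potential κ ω := by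
  have hle := hdom μ hμ.1 ω hω heq.symm.le
  exact ⟨hle, fun ν hν => (h ν hν).mono fun x hx => le_antisymm (hle x) hx⟩

/-- The projection of `ω` onto the cone satisfies `U^ω ≤ U^μ` n.e. on `A`, with equality `μ`-a.e.;
domination then gives `U^μ ≤ U^ω` everywhere. -/
theorem IsPerfectKernel.exists_innerBalayage_of_mem (hκ : IsPerfectKernel κ)
    (hdom : DominationPrinciple κ) (hA : IsStronglyClosedOn κ A) (hω : ω ∈ finiteEnergyCone κ) :
    ∃ σ, IsInnerBalayage κ A ω σ := by
  have hk := hκ.toIsKernel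
  obtain ⟨μ, hμ, hle, heq⟩ := hκ.exists_cone_minimizer hA (L := fun ν => pairing κ ν ω)
    (b := -pairing κ ω ω)
    (fun μ hμ ν hν => hκ.pairing_add_left hμ.1 hν.1 hω)
    (fun a μ hμ => hκ.pairing_smul_left a hω)
    (fun u hu ν hν h => hκ.tendsto_pairing (fun n => (hu n).1) hν.1 h hω)
    (fun ν hν => by have := hκ.sqDist_nonneg hν.1 hω; simp only [sqDist] at this; linarith)
  have hiff : ∀ {ν τ ρ : Measure X}, ν ∈ finiteEnergyCone κ → τ ∈ finiteEnergyCone κ →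
      ρ ∈ finiteEnergyCone κ → pairing κ ν τ ≤ pairing κ ν ρ →
      ∫⁻ x, potential κ τ x ∂ν ≤ ∫⁻ x, potential κ ρ x ∂ν := fun hν hτ hρ h => by
    rw [← hk.mutualEnergy_eq hτ.1, ← hk.mutualEnergy_eq hρ.1]
    exact (ENNReal.toReal_le_toReal (hκ.mutualEnergy_lt_top hν hτ).ne
      (hκ.mutualEnergy_lt_top hν hρ).ne).1 h
  obtain ⟨h1, h2⟩ := hk.potential_of_lintegral_le (hk.measurable_potential hω.1) hμ
    (fun ν hν => hiff hν.1 hω hμ.1 ((hle ν hν).trans_eq (hk.pairing_comm hμ.1 hν.1)))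
    (hiff hμ.1 hμ.1 hω heq.ge)
  exact ⟨μ, (hk.isInnerBalayage_iff hω.1).2
    ⟨hμ, (potential_eq_of_domination hdom hω.1 hμ h1 h2).2⟩⟩

/-- Under Ugaheri's maximum principle, measures on compact sets satisfy a principle of positivity
of mass. -/
theorem IsPerfectKernel.measure_univ_le (hκ : IsPerfectKernel κ) {M : ℝ≥0}
    (hM : UgaheriPrinciple κ M) (hK : IsCompact K) (hω : ω ∈ radonCone X)
    (hμ : μ ∈ finiteEnergyConeOn κ K) (h : ∀ x, potential κ μ x ≤ potential κ ω x) :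
    μ univ ≤ M * ω univ := by
  have hk := hκ.toIsKernel
  -- `γ` plays the role of an equilibrium measure of `K`: its potential is at least `1` n.e. on `K`
  -- and, by Ugaheri's principle, at most `M` everywhere.
  obtain ⟨γ, hγ, hge, heq⟩ := hκ.exists_potential_ge hK (g := fun _ => 1) measurable_const
    continuousOn_const (m := 1) (by simp)
  have hγM : ∀ x, potential κ γ x ≤ M := fun x => by
    simpa using hM γ hγ.1 1 one_pos (heq.mono fun x hx => by rw [← hx]; simp) x
  calc μ univ = ∫⁻ _, 1 ∂μ := by simp
    _ ≤ ∫⁻ x, potential κ γ x ∂μ := lintegral_mono_ae (hge μ hμ)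
    _ = ∫⁻ x, potential κ μ x ∂γ := hk.lintegral_potential_comm hγ.1.1 hμ.1.1
    _ ≤ ∫⁻ x, potential κ ω x ∂γ := lintegral_mono h
    _ = ∫⁻ x, potential κ γ x ∂ω := hk.lintegral_potential_comm hω hγ.1.1
    _ ≤ ∫⁻ _, M ∂ω := lintegral_mono hγM
    _ = M * ω univ := by simp

/-- The balayage of an admissible charge onto a compact subset of `A`, with an energy bound that
does not depend on the compact subset. -/
theorem IsPerfectKernel.exists_balayage_compact (hκ : IsPerfectKernel κ)
    (hdom : DominationPrinciple κ) {M : ℝ≥0} (hM : UgaheriPrinciple κ M)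
    (hω : ω ∈ radonCone X) (hadm : IsAdmissibleCharge κ A ω) :
    ∃ R : ℝ, ∀ K : Set X, IsCompact K → K ⊆ A → ∃ μ ∈ finiteEnergyConeOn κ K,
      pairing κ μ μ ≤ R ∧ ∀ ν ∈ finiteEnergyConeOn κ K, potential κ μ =ᵐ[ν] potential κ ω := by
  have hk := hκ.toIsKernel
  obtain ⟨m, hm⟩ := hadm.potential_bounded
  -- The bound comes from `I(μ) = ∫ U^μ dμ ≤ m * μ(X)` and `μ(X) ≤ M * ω(X)`.
  refine ⟨(m * (M * ω univ)).toReal, fun K hK hKA => ?_⟩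
  obtain ⟨μ, hμ, h1, h2⟩ := hκ.exists_potential_ge hK (hk.measurable_potential hω)
    (continuousOn_iff_lower_upperSemicontinuousOn.2
      ⟨hk.lowerSemicontinuous_potential.lowerSemicontinuousOn K, hadm.usc K hK hKA⟩)
    (fun x hx => hm x (hKA hx))
  obtain ⟨hle, heq⟩ := potential_eq_of_domination hdom hω hμ h1 h2
  refine ⟨μ, hμ, ENNReal.toReal_mono (ENNReal.mul_lt_top ENNReal.coe_lt_top
    (ENNReal.mul_lt_top ENNReal.coe_lt_top hadm.bounded)).ne ?_, heq⟩
  have hae : ∀ᵐ x ∂μ, x ∈ K := hμ.2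
  rw [hk.mutualEnergy_eq hμ.1.1]
  calc ∫⁻ x, potential κ μ x ∂μ ≤ ∫⁻ _, m ∂μ :=
        lintegral_mono_ae (hae.mono fun x hx => (hle x).trans (hm x (hKA hx)))
    _ = m * μ univ := by simp
    _ ≤ m * (M * ω univ) := by gcongr; exact hκ.measure_univ_le hM hK hω hμ hle

/-- Energies of the balayages `w K` increase with `K` and are bounded, and their increments are
squared distances. Compact sets with energies close to the supremum thus give a strongly convergent
sequence. -/
theorem IsPerfectKernel.exists_innerBalayage_of_isAdmissibleCharge (hκ : IsPerfectKernel κ)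
    (hdom : DominationPrinciple κ) {M : ℝ≥0} (hM : UgaheriPrinciple κ M)
    (hA : IsStronglyClosedOn κ A) (hω : ω ∈ radonCone X) (hadm : IsAdmissibleCharge κ A ω) :
    ∃ σ, IsInnerBalayage κ A ω σ := by
  have hk := hκ.toIsKernel
  obtain ⟨R, hR⟩ := hκ.exists_balayage_compact hdom hM hω hadm
  choose! w hwK hwR hweq using hR
  set T : Set (Set X) := {K | IsCompact K ∧ K ⊆ A} with hT
  have hwA : ∀ K ∈ T, w K ∈ finiteEnergyConeOn κ A := fun K hK =>
    finiteEnergyConeOn_mono hK.2 (hwK K hK.1 hK.2)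
  have hpair : ∀ K ∈ T, ∀ L ∈ T, K ⊆ L →
      sqDist κ (w L) (w K) = pairing κ (w L) (w L) - pairing κ (w K) (w K) := by
    intro K hK L hL hKL
    have h1 := hwK K hK.1 hK.2
    have h2 := hwK L hL.1 hL.2
    -- `w K` is concentrated on `K ⊆ L`, where both potentials equal `U^ω`; thus `w L - w K` is
    -- orthogonal to `w K`.
    have h3 : pairing κ (w L) (w K) = pairing κ (w K) (w K) := by
      rw [hk.pairing_comm h2.1 h1.1, pairing, pairing, hk.mutualEnergy_eq h2.1.1,
        hk.mutualEnergy_eq h1.1.1]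
      exact congrArg _ (lintegral_congr_ae ((hweq L hL.1 hL.2 _ (finiteEnergyConeOn_mono hKL h1)
        ).trans (hweq K hK.1 hK.2 _ h1).symm))
    rw [sqDist, h3]
    ring
  have hTne : T.Nonempty := ⟨∅, isCompact_empty, empty_subset _⟩
  set e : Set X → ℝ := fun K => pairing κ (w K) (w K)
  have hbdd : BddAbove (e '' T) := ⟨R, by rintro _ ⟨K, hK, rfl⟩; exact hwR K hK.1 hK.2⟩
  have hsup : ∀ K ∈ T, e K ≤ sSup (e '' T) := fun K hK => le_csSup hbdd ⟨K, hK, rfl⟩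
  have hex : ∀ n : ℕ, ∃ K ∈ T, sSup (e '' T) - 1 / ((n : ℝ) + 1) < e K := fun n => by
    obtain ⟨_, ⟨K, hK, rfl⟩, h⟩ := exists_lt_of_lt_csSup (hTne.image e)
      (sub_lt_self (sSup (e '' T)) (Nat.one_div_pos_of_nat (n := n)))
    exact ⟨K, hK, h⟩
  choose K hK hKe using hex
  have hunion : ∀ {K L : Set X}, K ∈ T → L ∈ T → K ∪ L ∈ T := fun hK hL =>
    ⟨hK.1.union hL.1, union_subset hK.2 hL.2⟩
  have hdist : ∀ n, ∀ L ∈ T, sqDist κ (w (K n ∪ L)) (w (K n)) ≤ 1 / ((n : ℝ) + 1) := by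
    intro n L hL
    rw [hpair _ (hK n) _ (hunion (hK n) hL) subset_union_left]
    have h1 := hsup _ (hunion (hK n) hL)
    have h2 := hKe n
    simp only [e] at h1 h2
    linarith
  have hlim : Tendsto (fun n : ℕ => 1 / ((n : ℝ) + 1)) atTop (𝓝 0) :=
    tendsto_one_div_add_atTop_nhds_zero_nat
  have hwn : ∀ n, w (K n) ∈ finiteEnergyConeOn κ A := fun n => hwA _ (hK n)
  obtain ⟨σ, hσ, hconv⟩ := hκ.exists_strong_limit (fun n => (hwn n).1)
    (b := fun n => 2 * (1 / ((n : ℝ) + 1))) (by simpa using hlim.const_mul 2) fun m n _ => by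
      -- Neither compact set need contain the other, so both balayages are compared with the one
      -- onto the union.
      have hU := (hwA _ (hunion (hK m) (hK n))).1
      have h1 := hκ.sqDist_le (hwn m).1 (hwn n).1 hU
      have h2 := hdist m _ (hK n)
      have h3 := hdist n _ (hK m)
      rw [union_comm] at h3
      rw [hκ.sqDist_comm hU (hwn m).1] at h2
      linarith
  have hσA := hA _ hwn σ hσ hconv
  rw [hκ.strongTendsto_iff (fun n => (hwn n).1) hσ] at hconv
  have hK_eq : ∀ L ∈ T, ∀ ν ∈ finiteEnergyConeOn κ L, potential κ σ =ᵐ[ν] potential κ ω := by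
    intro L hL
    have hU : ∀ n, w (K n ∪ L) ∈ finiteEnergyCone κ := fun n => (hwA _ (hunion (hK n) hL)).1
    -- Adjoining `L` does not change the limit, while every `w (K n ∪ L)` already has the right
    -- potential on `L`.
    have hconvL : StrongTendsto κ (fun n => w (K n ∪ L)) σ := by
      rw [hκ.strongTendsto_iff hU hσ]
      refine squeeze_zero (fun n => hκ.sqDist_nonneg (hU n) hσ)
        (fun n => hκ.sqDist_le (hU n) hσ (hwn n).1) ?_
      have h0 : Tendsto (fun n => sqDist κ (w (K n ∪ L)) (w (K n))) atTop (𝓝 0) :=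
        squeeze_zero (fun n => hκ.sqDist_nonneg (hU n) (hwn n).1) (fun n => hdist n L hL) hlim
      simpa using (h0.const_mul 2).add (hconv.const_mul 2)
    have hint : ∀ ν ∈ finiteEnergyConeOn κ L,
        ∫⁻ x, potential κ σ x ∂ν = ∫⁻ x, potential κ ω x ∂ν := by
      intro ν hν
      have h1 : ∀ n, ∫⁻ x, potential κ ω x ∂ν = mutualEnergy κ ν (w (K n ∪ L)) := fun n => by
        rw [hk.mutualEnergy_eq (hU n).1]
        have hT' := hunion (hK n) hL
        exact lintegral_congr_ae (hweq _ hT'.1 hT'.2 ν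
          (finiteEnergyConeOn_mono subset_union_right hν)).symm
      have h2 := hκ.tendsto_pairing hU hσ hconvL hν.1
      have h3 : ∀ n, pairing κ (w (K n ∪ L)) ν = (∫⁻ x, potential κ ω x ∂ν).toReal := fun n => by
        rw [h1 n, hk.pairing_comm (hU n) hν.1, pairing]
      simp only [h3] at h2
      have h4 := tendsto_nhds_unique h2 tendsto_const_nhds
      rw [← hk.mutualEnergy_eq hσ.1]
      refine (ENNReal.toReal_eq_toReal_iff' (hκ.mutualEnergy_lt_top hν.1 hσ).ne ?_).1 ?_
      · rw [h1 0]
        exact (hκ.mutualEnergy_lt_top hν.1 (hU 0)).ne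
      · rw [← h4, hk.pairing_comm hσ hν.1, pairing]
    intro ν hν
    exact (hk.ae_le_of_forall_lintegral_le (hk.measurable_potential hσ.1)
      (fun ν hν => (hint ν hν).le) hν).antisymm
      (hk.ae_le_of_forall_lintegral_le (hk.measurable_potential hω)
        (fun ν hν => (hint ν hν).ge) hν)
  refine ⟨σ, (hk.isInnerBalayage_iff hω).2 ⟨hσA, fun ν hν => ?_⟩⟩
  have hS := measurableSet_eq_fun (hk.measurable_potential hσ.1) (hk.measurable_potential hω)
  by_contra hpos
  obtain ⟨L, hL, hLA, hLpos⟩ :=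
    exists_isCompact_subset_of_lt_measure hν hS.compl (pos_iff_ne_zero.2 hpos)
  have hmem : ν.restrict L ∈ finiteEnergyConeOn κ L :=
    ⟨hk.mem_of_le hν.1 Measure.restrict_le_self, by
      rw [Measure.restrict_apply hL.measurableSet.compl]; simp⟩
  have := hK_eq L ⟨hL, hLA.trans inter_subset_left⟩ _ hmem
  have h0 : ν.restrict L {x | potential κ σ x = potential κ ω x}ᶜ = 0 := this
  rw [Measure.restrict_apply hS.compl, inter_eq_right.2 (hLA.trans inter_subset_right)] at h0
  exact hLpos.ne' h0

/-! ### The Gauss problem as a metric projection -/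

theorem IsPerfectKernel.gaussFunctional_eq (hκ : IsPerfectKernel κ) (hω : ω ∈ radonCone X)
    (hσ : IsInnerBalayage κ A ω σ) (hν : ν ∈ finiteEnergyConeOn κ A) :
    gaussFunctional κ ω ν = ((sqDist κ ν σ - pairing κ σ σ : ℝ) : EReal) := by
  have hk := hκ.toIsKernel
  obtain ⟨hσA, hσω⟩ := (hk.isInnerBalayage_iff hω).1 hσ
  rw [gaussFunctional, ← lintegral_congr_ae (hσω ν hν), ← hk.mutualEnergy_eq hσA.1.1,
    ← EReal.coe_ennreal_toReal hν.1.2.ne,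
    ← EReal.coe_ennreal_toReal (hκ.mutualEnergy_lt_top hν.1 hσA.1).ne, sqDist]
  change ((pairing κ ν ν : ℝ) : EReal) - 2 * ((pairing κ ν σ : ℝ) : EReal) = _
  rw [show (2 : EReal) = ((2 : ℝ) : EReal) from rfl, ← EReal.coe_mul, ← EReal.coe_sub]
  congr 1
  ring

theorem IsPerfectKernel.isGaussSolution_iff (hκ : IsPerfectKernel κ) (hω : ω ∈ radonCone X)
    (hσ : IsInnerBalayage κ A ω σ) :
    IsGaussSolution κ A ω ν ↔ ν ∈ unitFiniteEnergyOn κ A ∧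
      ∀ μ ∈ unitFiniteEnergyOn κ A, sqDist κ ν σ ≤ sqDist κ μ σ := by
  have hcmp : ∀ {μ ν : Measure X}, μ ∈ unitFiniteEnergyOn κ A → ν ∈ unitFiniteEnergyOn κ A →
      (gaussFunctional κ ω ν ≤ gaussFunctional κ ω μ ↔ sqDist κ ν σ ≤ sqDist κ μ σ) := by
    intro μ ν hμ hν
    rw [hκ.gaussFunctional_eq hω hσ hμ.1, hκ.gaussFunctional_eq hω hσ hν.1, EReal.coe_le_coe_iff,
      sub_le_sub_iff_right]
  constructor
  · intro h
    exact ⟨h.mem, fun μ hμ => (hcmp hμ h.mem).1 (h.isMin.trans_le (iInf₂_le μ hμ))⟩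
  · rintro ⟨hν, h⟩
    exact ⟨hν, le_antisymm (le_iInf₂ fun μ hμ => (hcmp hμ hν).2 (h μ hμ)) (iInf₂_le ν hν)⟩

/-- The squared distance to a measure along the segment between two measures. -/
theorem IsPerfectKernel.sqDist_segment (hκ : IsPerfectKernel κ) (hμ : μ ∈ finiteEnergyCone κ)
    (hν : ν ∈ finiteEnergyCone κ) (hσ : σ ∈ finiteEnergyCone κ) {a b : ℝ≥0} (hab : a + b = 1) :
    sqDist κ (a • μ + b • ν) σ =
      a * sqDist κ μ σ + b * sqDist κ ν σ - a * b * sqDist κ μ ν := by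
  have hk := hκ.toIsKernel
  have ha := hk.smul_mem a hμ
  have hb := hk.smul_mem b hν
  have hs := hκ.add_mem ha hb
  simp only [sqDist, hκ.pairing_add_left ha hb hs, hκ.pairing_add_left ha hb hσ,
    hκ.pairing_smul_left a hs, hκ.pairing_smul_left b hs, hκ.pairing_smul_left a hσ,
    hκ.pairing_smul_left b hσ, hκ.pairing_add_right ha hb hμ, hκ.pairing_add_right ha hb hν,
    hκ.pairing_smul_right a hμ hμ, hκ.pairing_smul_right b hν hμ, hκ.pairing_smul_right a hμ hν,
    hκ.pairing_smul_right b hν hν, hk.pairing_comm hν hμ]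
  have hb' : (b : ℝ) = 1 - a := by
    rw [← NNReal.coe_one, ← hab]
    push_cast
    ring
  rw [hb']
  ring

theorem unit_convex (hκ : IsPerfectKernel κ) (hμ : μ ∈ unitFiniteEnergyOn κ A)
    (hν : ν ∈ unitFiniteEnergyOn κ A) {a b : ℝ≥0} (hab : a + b = 1) :
    a • μ + b • ν ∈ unitFiniteEnergyOn κ A := by
  refine ⟨hκ.add_memOn (hκ.toIsKernel.smul_memOn a hμ.1) (hκ.toIsKernel.smul_memOn b hν.1), ?_⟩
  simp only [Measure.add_apply, Measure.smul_apply, hμ.2, hν.2, ENNReal.smul_def, smul_eq_mul,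
    mul_one]
  exact_mod_cast hab

/-- The midpoint of two nearest points would be nearer to `σ` by `‖μ - ν‖² / 4` in squared distance.
-/
theorem IsPerfectKernel.isGaussSolution_unique (hκ : IsPerfectKernel κ) (hω : ω ∈ radonCone X)
    (hσ : IsInnerBalayage κ A ω σ) (hμ : IsGaussSolution κ A ω μ)
    (hν : IsGaussSolution κ A ω ν) : μ = ν := by
  rw [hκ.isGaussSolution_iff hω hσ] at hμ hν
  obtain ⟨hμ, hμmin⟩ := hμ
  obtain ⟨hν, hνmin⟩ := hν
  have hab : (2⁻¹ : ℝ≥0) + 2⁻¹ = 1 := by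
    rw [← NNReal.coe_inj]; push_cast; norm_num
  refine hκ.eq_of_sqDist_eq_zero hμ.1.1 hν.1.1 (le_antisymm ?_ (hκ.sqDist_nonneg hμ.1.1 hν.1.1))
  have h1 := hμmin _ (unit_convex hκ hμ hν hab)
  have h2 := hνmin _ hμ
  rw [hκ.sqDist_segment hμ.1.1 hν.1.1 hσ.mem.1 hab] at h1
  push_cast at h1
  linarith

theorem IsPerfectKernel.exists_nearest (hκ : IsPerfectKernel κ) {C : Set (Measure X)}
    (hC : C ⊆ finiteEnergyCone κ) (hne : C.Nonempty)
    (hmid : ∀ μ ∈ C, ∀ ν ∈ C, (2⁻¹ : ℝ≥0) • (μ + ν) ∈ C)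
    (hclosed : ∀ u : ℕ → Measure X, (∀ n, u n ∈ C) → ∀ ν ∈ finiteEnergyCone κ,
      StrongTendsto κ u ν → ν ∈ C) (hσ : σ ∈ finiteEnergyCone κ) :
    ∃ ν ∈ C, ∀ μ ∈ C, sqDist κ ν σ ≤ sqDist κ μ σ := by
  obtain ⟨ν, hν, h⟩ := hκ.exists_minimizer hC hne hmid hclosed (L := fun μ => pairing κ μ σ)
    (b := -pairing κ σ σ)
    (fun μ hμ ν hν => by
      rw [hκ.pairing_smul_left _ hσ, hκ.pairing_add_left (hC hμ) (hC hν) hσ]; push_cast; ring)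
    (fun u hu ν hν h => hκ.tendsto_pairing (fun n => hC (hu n)) (hC hν) h hσ)
    (fun μ hμ => by
      have := hκ.sqDist_nonneg (hC hμ) hσ; simp only [sqDist] at this; linarith)
  refine ⟨ν, hν, fun μ hμ => ?_⟩
  have := h μ hμ
  simp only [sqDist]
  linarith

/-! ### Finite inner capacity and tightness -/

theorem half_smul_add_mem (hκ : IsPerfectKernel κ) (hμ : μ ∈ unitFiniteEnergyOn κ A)
    (hν : ν ∈ unitFiniteEnergyOn κ A) : (2⁻¹ : ℝ≥0) • (μ + ν) ∈ unitFiniteEnergyOn κ A := by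
  rw [smul_add]
  exact unit_convex hκ hμ hν (by rw [← NNReal.coe_inj]; push_cast; norm_num)

theorem unitFiniteEnergyOn_nonempty (hA : 0 < innerCapacity κ A) :
    (unitFiniteEnergyOn κ A).Nonempty := by
  obtain ⟨μ, hμ, -⟩ := exists_unit_of_lt_innerCapacity hA
  exact ⟨μ, hμ⟩

/-- On a set of finite inner capacity, unit measures that escape to infinity have unbounded
energies. -/
theorem IsPerfectKernel.exists_energy_gt (hκ : IsPerfectKernel κ) (hA : innerCapacity κ A < ∞)
    (R : ℝ) : ∃ K : Set X, IsCompact K ∧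
      ∀ μ ∈ unitFiniteEnergyOn κ (A \ K), R < pairing κ μ μ := by
  by_contra! hcon
  obtain ⟨δ, hδ, hle⟩ := hκ.exists_pos_le_energy hA
  let E : CompactExhaustion X := default
  set C : ℕ → Set (Measure X) := fun n => unitFiniteEnergyOn κ (A \ E n)
  set f : Measure X → ℝ := fun μ => pairing κ μ μ
  have hCanti : ∀ {m n}, m ≤ n → C n ⊆ C m := fun h μ hμ =>
    ⟨finiteEnergyConeOn_mono (sdiff_subset_sdiff_right (E.subset h)) hμ.1, hμ.2⟩
  have hCA : ∀ {n μ}, μ ∈ C n → μ ∈ unitFiniteEnergyOn κ A := fun hμ =>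
    ⟨finiteEnergyConeOn_mono sdiff_subset hμ.1, hμ.2⟩
  have hex : ∀ n, ∃ μ ∈ C n, f μ ≤ R := fun n => hcon (E n) (E.isCompact n)
  have hne : ∀ n, (C n).Nonempty := fun n => (hex n).imp fun μ h => h.1
  have hbdd : ∀ n, BddBelow (f '' C n) := fun n =>
    ⟨0, by rintro _ ⟨μ, -, rfl⟩; exact pairing_nonneg⟩
  set s : ℕ → ℝ := fun n => sInf (f '' C n) with hs
  have hmono : Monotone s := fun m n h =>
    csInf_le_csInf (hbdd m) ((hne n).image f) (image_mono (hCanti h))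
  have hsR : ∀ n, s n ≤ R := fun n => by
    obtain ⟨μ, hμ, h⟩ := hex n
    exact (csInf_le (hbdd n) ⟨μ, hμ, rfl⟩).trans h
  obtain ⟨l, hl⟩ : ∃ l, Tendsto s atTop (𝓝 l) :=
    ⟨_, tendsto_atTop_ciSup hmono ⟨R, by rintro _ ⟨n, rfl⟩; exact hsR n⟩⟩
  have hsl : ∀ n, s n ≤ l := fun n => hmono.ge_of_tendsto hl n
  have hex2 : ∀ n : ℕ, ∃ μ ∈ C n, f μ < s n + 1 / ((n : ℝ) + 1) := fun n => by
    obtain ⟨_, ⟨μ, hμ, rfl⟩, h⟩ := exists_lt_of_csInf_lt ((hne n).image f)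
      (lt_add_of_pos_right (s n) (Nat.one_div_pos_of_nat (n := n)))
    exact ⟨μ, hμ, h⟩
  choose u hu hus using hex2
  have huE : ∀ n, u n ∈ finiteEnergyCone κ := fun n => (hu n).1.1
  have hlim : Tendsto (fun n : ℕ => 1 / ((n : ℝ) + 1)) atTop (𝓝 0) :=
    tendsto_one_div_add_atTop_nhds_zero_nat
  -- For `m ≤ n` the midpoint of `u m` and `u n` lies in `C m`, so its energy is at least `s m`. As
  -- `s` increases to `l`, the parallelogram law makes `u` strongly Cauchy.
  obtain ⟨τ, hτ, hconv⟩ := hκ.exists_strong_limit huE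
    (b := fun n => 2 * (1 / ((n : ℝ) + 1)) + 4 * (l - s n))
    (by simpa using (hlim.const_mul 2).add ((hl.const_sub l).const_mul 4)) fun m n h => by
      have hmid : s m ≤ f ((2⁻¹ : ℝ≥0) • (u m + u n)) :=
        csInf_le (hbdd m) ⟨_, half_smul_add_mem hκ (hu m) (hCanti h (hu n)), rfl⟩
      have h1 := hus m
      have h2 := hus n
      have h3 := hsl n
      have h4 := hsl m
      rw [hκ.sqDist_eq_midpoint (huE m) (huE n)]
      simp only [f] at hmid h1 h2
      linarith
  -- The measures `u n` leave every compact set, so their vague limit vanishes; yet its energy is at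
  -- least `δ`.
  have hτ0 : τ = 0 := by
    rw [← Measure.measure_univ_eq_zero, ← E.iUnion_eq]
    refine measure_iUnion_null fun k => ?_
    refine measure_mono_null (E.subset_interior_succ k) (nonpos_iff_eq_zero.1 ?_)
    refine (hκ.consistency.finer u huE τ hτ hconv).measure_le_of_isOpen (fun n => (huE n).1) hτ.1
      isOpen_interior ((eventually_ge_atTop (k + 1)).mono fun n hn => le_of_eq ?_)
    exact measure_mono_null (t := (A \ E n)ᶜ)
      (fun x hx hx' => hx'.2 (E.subset hn (interior_subset hx))) (hu n).1.2
  have hen := hκ.tendsto_energy huE hτ hconv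
  have hge : δ ≤ pairing κ τ τ := ge_of_tendsto' hen fun n => hle _ (hCA (hu n))
  rw [hτ0] at hge
  simp only [pairing, mutualEnergy, Measure.zero_prod, lintegral_zero_measure,
    ENNReal.toReal_zero] at hge
  linarith

/-- On a set of finite inner capacity, unit measures of bounded energy are uniformly tight. -/
theorem IsPerfectKernel.exists_compact_measure_compl_le (hκ : IsPerfectKernel κ)
    (hA : innerCapacity κ A < ∞) (R : ℝ) {ε : ℝ≥0} (hε : 0 < ε) :
    ∃ K : Set X, IsCompact K ∧
      ∀ μ ∈ unitFiniteEnergyOn κ A, pairing κ μ μ ≤ R → μ Kᶜ ≤ ε := by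
  -- If `μ Kᶜ > ε`, normalizing `μ` on `Kᶜ` multiplies the energy bound by at most `ε⁻²`.
  obtain ⟨K, hK, h⟩ := hκ.exists_energy_gt hA ((ε : ℝ)⁻¹ ^ 2 * R)
  refine ⟨K, hK, fun μ hμ hR => ?_⟩
  by_contra! hlt
  have hfin : μ Kᶜ ≠ ∞ := ((measure_mono (subset_univ _)).trans_lt
    (hμ.2.trans_lt ENNReal.one_lt_top)).ne
  have hm := hκ.toIsKernel.normalizedRestrict_mem hμ.1 (ne_bot_of_gt hlt) hfin
  have h1 := h (normalizedRestrict μ Kᶜ) ⟨⟨hm.1.1, by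
    rw [sdiff_eq_compl_inter, compl_inter]
    exact measure_union_null (normalizedRestrict_compl hK.measurableSet.compl) hm.1.2⟩, hm.2⟩
  have h2 := hκ.pairing_normalizedRestrict_le hμ.1.1 (S := Kᶜ)
  have h3 : (ε : ℝ) ≤ (μ Kᶜ).toReal := by simpa using ENNReal.toReal_mono hfin hlt.le
  have h4 : (μ Kᶜ).toReal⁻¹ ^ 2 ≤ (ε : ℝ)⁻¹ ^ 2 := by gcongr
  have h5 : 0 ≤ pairing κ μ μ := pairing_nonneg
  have h6 := mul_le_mul h4 hR h5 (by positivity)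
  linarith

/-- A vague limit can only lose mass. Strong convergence bounds the energies eventually, so
tightness excludes the loss. -/
theorem IsPerfectKernel.unit_closed (hκ : IsPerfectKernel κ) (hA : innerCapacity κ A < ∞)
    (hAclosed : IsStronglyClosedOn κ A) {u : ℕ → Measure X}
    (hu : ∀ n, u n ∈ unitFiniteEnergyOn κ A) (hν : ν ∈ finiteEnergyCone κ)
    (h : StrongTendsto κ u ν) : ν ∈ unitFiniteEnergyOn κ A := by
  have huE : ∀ n, u n ∈ finiteEnergyCone κ := fun n => (hu n).1.1
  have hvague := hκ.consistency.finer u huE ν hν h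
  refine ⟨hAclosed u (fun n => (hu n).1) ν hν h, le_antisymm ?_ ?_⟩
  · exact hvague.measure_le_of_isOpen (fun n => (huE n).1) hν.1 isOpen_univ
      (Eventually.of_forall fun n => (hu n).2.le)
  · refine ENNReal.le_of_forall_pos_le_add fun ε hε _ => ?_
    have hb : ∀ᶠ n in atTop, pairing κ (u n) (u n) ≤ pairing κ ν ν + 1 :=
      (hκ.tendsto_energy huE hν h).eventually_le_const (lt_add_one _)
    obtain ⟨K, hK, htight⟩ := hκ.exists_compact_measure_compl_le hA (pairing κ ν ν + 1) hε
    obtain ⟨φ, h1, -, hsupp, h0⟩ := exists_continuous_one_zero_of_isCompact hK isClosed_empty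
      (disjoint_empty K)
    have hφ : ENNReal.ofReal (∫ x, φ x ∂ν) ≤ ν univ :=
      ofReal_integral_le hν.1 φ.continuous hsupp h0 .univ (subset_univ _)
    have hlim := ((ENNReal.continuous_ofReal.tendsto _).comp
      (hvague φ φ.continuous hsupp)).add_const (ε : ℝ≥0∞)
    refine (ge_of_tendsto hlim (hb.mono fun n hn => ?_)).trans (add_le_add_left hφ _)
    calc (1 : ℝ≥0∞) = u n univ := (hu n).2.symm
      _ ≤ u n K + u n Kᶜ := by rw [← union_compl_self K]; exact measure_union_le _ _
      _ ≤ _ := add_le_add (le_ofReal_integral (huE n).1 φ.continuous hsupp (fun x => (h0 x).1)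
          hK.measurableSet fun x hx => (h1 hx).ge) (htight _ (hu n) hn)

/-! ### Solvability of the Gauss problem -/

theorem IsPerfectKernel.exists_isGaussSolution_of_finite (hκ : IsPerfectKernel κ)
    (hA0 : 0 < innerCapacity κ A) (hA : innerCapacity κ A < ∞) (hAclosed : IsStronglyClosedOn κ A)
    (hω : ω ∈ radonCone X) (hσ : IsInnerBalayage κ A ω σ) : ∃ ν, IsGaussSolution κ A ω ν := by
  obtain ⟨ν, hν⟩ := hκ.exists_nearest (C := unitFiniteEnergyOn κ A) (fun μ h => h.1.1)
    (unitFiniteEnergyOn_nonempty hA0) (fun μ hμ ν hν => half_smul_add_mem hκ hμ hν)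
    (fun u hu ν hν h => hκ.unit_closed hA hAclosed hu hν h) hσ.mem.1
  exact ⟨ν, (hκ.isGaussSolution_iff hω hσ).2 hν⟩

theorem IsPerfectKernel.isGaussSolution_of_unit (hκ : IsPerfectKernel κ) (hω : ω ∈ radonCone X)
    (hσ : IsInnerBalayage κ A ω σ) (h1 : σ univ = 1) : IsGaussSolution κ A ω σ := by
  refine (hκ.isGaussSolution_iff hω hσ).2 ⟨⟨hσ.mem, h1⟩, fun μ hμ => ?_⟩
  rw [sqDist_self]
  exact hκ.sqDist_nonneg hμ.1.1 hσ.mem.1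

/-- Infinite capacity provides unit measures `τ` on `A` of arbitrarily small energy. The competitors
`σ + (1 - σ(X))τ` then approach `σ`, so a solution would have to be `σ`, whose mass is less than
one. -/
theorem IsPerfectKernel.not_exists_isGaussSolution (hκ : IsPerfectKernel κ)
    (hω : ω ∈ radonCone X) (hA : innerCapacity κ A = ∞) (hσ : IsInnerBalayage κ A ω σ)
    (h1 : σ univ < 1) : ¬ ∃ ν, IsGaussSolution κ A ω ν := by
  rintro ⟨ν, hν⟩
  have hk := hκ.toIsKernel
  obtain ⟨hν, hmin⟩ := (hκ.isGaussSolution_iff hω hσ).1 hν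
  have hzero : sqDist κ ν σ ≤ 0 := by
    refine le_of_forall_pos_le_add fun ε hε => ?_
    obtain ⟨τ, hτ, hlt⟩ := exists_unit_of_lt_innerCapacity (κ := κ) (A := A)
      (r := (ENNReal.ofReal ε)⁻¹) (by rw [hA]; simpa using hε)
    rw [inv_inv] at hlt
    have hτε : pairing κ τ τ ≤ ε := by
      have := ENNReal.toReal_mono ENNReal.ofReal_ne_top hlt.le
      rwa [ENNReal.toReal_ofReal hε.le] at this
    have hσf : σ univ ≠ ∞ := h1.ne_top
    set a : ℝ≥0 := 1 - (σ univ).toNNReal with ha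
    have hle : (σ univ).toNNReal ≤ 1 := ENNReal.toNNReal_mono ENNReal.one_ne_top h1.le
    have hat := hk.smul_memOn a hτ.1
    have hs := hκ.add_memOn hσ.mem hat
    have hmem : σ + a • τ ∈ unitFiniteEnergyOn κ A := by
      refine ⟨hs, ?_⟩
      rw [Measure.add_apply, Measure.smul_apply, hτ.2, ENNReal.smul_def, smul_eq_mul, mul_one,
        ← ENNReal.coe_toNNReal hσf, ha]
      exact_mod_cast add_tsub_cancel_of_le hle
    refine (hmin _ hmem).trans ?_
    have ha1 : (a : ℝ) ≤ 1 := by exact_mod_cast (tsub_le_self : a ≤ 1)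
    have ha0 := a.coe_nonneg
    simp only [sqDist, hκ.pairing_add_left hσ.mem.1 hat.1 hs.1,
      hκ.pairing_add_left hσ.mem.1 hat.1 hσ.mem.1, hκ.pairing_smul_left a hs.1,
      hκ.pairing_smul_left a hσ.mem.1, hκ.pairing_add_right hσ.mem.1 hat.1 hσ.mem.1,
      hκ.pairing_add_right hσ.mem.1 hat.1 hτ.1.1, hκ.pairing_smul_right a hτ.1.1 hσ.mem.1,
      hκ.pairing_smul_right a hτ.1.1 hτ.1.1, hk.pairing_comm hσ.mem.1 hτ.1.1]
    have h2 : (a : ℝ) * (a * pairing κ τ τ) ≤ ε :=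
      calc (a : ℝ) * (a * pairing κ τ τ) ≤ 1 * (1 * pairing κ τ τ) := by
            have := pairing_nonneg (κ := κ) (μ := τ) (ν := τ)
            gcongr
        _ ≤ ε := by linarith
    linarith
  have := hκ.eq_of_sqDist_eq_zero hν.1.1 hσ.mem.1
    (le_antisymm hzero (hκ.sqDist_nonneg hν.1.1 hσ.mem.1))
  rw [← this, hν.2] at h1
  exact lt_irrefl _ h1

/-- A measure of finite energy is strongly approximated by its restrictions to compact sets. -/
theorem IsPerfectKernel.exists_restrict_sqDist_lt (hκ : IsPerfectKernel κ)
    (hσ : σ ∈ finiteEnergyCone κ) {ε : ℝ} (hε : 0 < ε) :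
    ∃ K : Set X, IsCompact K ∧ sqDist κ (σ.restrict K) σ < ε := by
  have hk := hκ.toIsKernel
  let E : CompactExhaustion X := default
  have hsup : energy κ σ = ⨆ n, mutualEnergy κ (σ.restrict (E n)) σ := by
    simp only [energy, hk.mutualEnergy_eq hσ.1]
    rw [← setLIntegral_iUnion_of_directed _
      (directed_of_isDirected_le fun m n h => E.subset h), E.iUnion_eq, Measure.restrict_univ]
  have hmono : Monotone fun n => mutualEnergy κ (σ.restrict (E n)) σ := fun m n h =>
    hk.mutualEnergy_mono (mem_radonCone_of_le hσ.1 Measure.restrict_le_self) hσ.1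
      (Measure.restrict_mono (E.subset h) le_rfl) le_rfl
  have hlim := tendsto_atTop_iSup hmono
  rw [← hsup] at hlim
  have hlim' := (ENNReal.tendsto_toReal hσ.2.ne).comp hlim
  obtain ⟨n, hn⟩ := (hlim'.eventually_const_lt (sub_lt_self _ hε)).exists
  refine ⟨E n, E.isCompact n, ?_⟩
  have hr := hk.mem_of_le hσ (Measure.restrict_le_self (s := E n))
  -- Hence `‖σ|_K - σ‖² ≤ I(σ) - I(σ|_K, σ)`, which is small by monotone convergence.
  have hle : pairing κ (σ.restrict (E n)) (σ.restrict (E n)) ≤ pairing κ (σ.restrict (E n)) σ :=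
    ENNReal.toReal_mono (hκ.mutualEnergy_lt_top hr hσ).ne
      (hk.mutualEnergy_mono hr.1 hσ.1 le_rfl Measure.restrict_le_self)
  change pairing κ σ σ - ε < pairing κ (σ.restrict (E n)) σ at hn
  rw [sqDist]
  linarith

/-- The choice `t = (1 - a) / (1 - a + b)` lies in `(0, 1]` without any comparison of `a` and `b`,
and `t * (b - a) ≤ 1 - a`. -/
theorem exists_segment_mass_le {a b : ℝ≥0∞} (ha : a < 1) (hb : b ≠ ∞) :
    ∃ s t : ℝ≥0, s + t = 1 ∧ 0 < t ∧ (s : ℝ≥0∞) * a + t * b ≤ 1 := by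
  lift a to ℝ≥0 using ha.ne_top
  lift b to ℝ≥0 using hb
  have ha' : (a : ℝ) < 1 := by exact_mod_cast ha
  have hden : 0 < 1 - (a : ℝ) + b := by linarith [b.coe_nonneg]
  have ht0 : 0 < (1 - (a : ℝ)) / (1 - a + b) := div_pos (by linarith) hden
  have ht1 : (1 - (a : ℝ)) / (1 - a + b) ≤ 1 := by
    rw [div_le_one hden]
    linarith [b.coe_nonneg]
  obtain ⟨t, ht⟩ : ∃ t : ℝ≥0, (t : ℝ) = (1 - (a : ℝ)) / (1 - a + b) := ⟨⟨_, ht0.le⟩, rfl⟩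
  have htle : t ≤ 1 := by rw [← NNReal.coe_le_coe, ht]; exact ht1
  refine ⟨1 - t, t, tsub_add_cancel_of_le htle, by rw [← NNReal.coe_pos, ht]; exact ht0, ?_⟩
  norm_cast
  rw [← NNReal.coe_le_coe]
  push_cast [htle]
  have h2 : (t : ℝ) * (1 - a + b) = 1 - a := by rw [ht, div_mul_cancel₀ _ hden.ne']
  nlinarith [t.coe_nonneg, a.coe_nonneg]

theorem IsPerfectKernel.exists_isGaussSolution_of_one_lt (hκ : IsPerfectKernel κ)
    (hAclosed : IsStronglyClosedOn κ A) (hω : ω ∈ radonCone X) (hσ : IsInnerBalayage κ A ω σ)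
    (h1 : 1 < σ univ) : ∃ ν, IsGaussSolution κ A ω ν := by
  have hk := hκ.toIsKernel
  obtain ⟨ν, ⟨hν, hν1⟩, hmin⟩ := hκ.exists_nearest
    (C := {μ | μ ∈ finiteEnergyConeOn κ A ∧ μ univ ≤ 1}) (fun μ h => h.1.1)
    ⟨0, zero_mem_finiteEnergyConeOn, by simp⟩
    (fun μ hμ ν hν => ⟨hk.smul_memOn _ (hκ.add_memOn hμ.1 hν.1), by
      rw [Measure.smul_apply, Measure.add_apply, ENNReal.smul_def, smul_eq_mul]
      calc ((2⁻¹ : ℝ≥0) : ℝ≥0∞) * (μ univ + ν univ) ≤ ((2⁻¹ : ℝ≥0) : ℝ≥0∞) * (1 + 1) := by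
            gcongr
            · exact hμ.2
            · exact hν.2
        _ = 1 := by
            norm_cast
            rw [← NNReal.coe_inj]; push_cast; norm_num⟩)
    (fun u hu ν hν h => ⟨hAclosed u (fun n => (hu n).1) ν hν h,
      (hκ.consistency.finer u (fun n => (hu n).1.1) ν hν h).measure_le_of_isOpen
        (fun n => (hu n).1.1.1) hν.1 isOpen_univ (Eventually.of_forall fun n => (hu n).2)⟩)
    hσ.mem.1
  rcases hν1.lt_or_eq with hlt | heq
  · exfalso
    have hpos : 0 < sqDist κ ν σ := by
      refine lt_of_le_of_ne (hκ.sqDist_nonneg hν.1 hσ.mem.1) fun h => ?_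
      rw [← hκ.eq_of_sqDist_eq_zero hν.1 hσ.mem.1 h.symm] at h1
      exact lt_asymm h1 hlt
    -- `σ` may have infinite mass, so `ν` is moved towards a finite restriction of `σ` that is
    -- nearer to `σ` than `ν` is. A short move keeps the mass at most one and contradicts
    -- minimality.
    obtain ⟨K, hK, hKlt⟩ := hκ.exists_restrict_sqDist_lt hσ.mem.1 hpos
    have hτ := hk.memOn_of_le hσ.mem (Measure.restrict_le_self (s := K))
    have : IsFiniteMeasureOnCompacts σ := hσ.mem.1.1
    obtain ⟨s, t, hst, ht, hmass⟩ := exists_segment_mass_le (b := σ.restrict K univ) hlt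
      (by rw [Measure.restrict_apply_univ]; exact hK.measure_lt_top.ne)
    have h2 := hmin (s • ν + t • σ.restrict K)
      ⟨hκ.add_memOn (hk.smul_memOn s hν) (hk.smul_memOn t hτ), by
        rw [Measure.add_apply, Measure.smul_apply, Measure.smul_apply, ENNReal.smul_def,
          ENNReal.smul_def, smul_eq_mul, smul_eq_mul]
        exact hmass⟩
    rw [hκ.sqDist_segment hν.1 hτ.1 hσ.mem.1 hst] at h2
    have h3 : (s : ℝ) = 1 - t := by
      rw [← NNReal.coe_one, ← hst]
      push_cast
      ring
    have h4 : 0 ≤ (s : ℝ) * t * sqDist κ ν (σ.restrict K) :=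
      mul_nonneg (by positivity) (hκ.sqDist_nonneg hν.1 hτ.1)
    have h5 : (t : ℝ) * sqDist κ (σ.restrict K) σ < t * sqDist κ ν σ :=
      mul_lt_mul_of_pos_left hKlt (by exact_mod_cast ht)
    rw [h3] at h2 h4
    linarith
  · exact ⟨ν, (hκ.isGaussSolution_iff hω hσ).2 ⟨⟨hν, heq⟩, fun μ hμ => hmin μ ⟨hμ.1, hμ.2.le⟩⟩⟩

end PotentialTheory

end

theorem mainTheorem3 {X : Type*} [TopologicalSpace X] [T2Space X] [LocallyCompactSpace X]
    [SecondCountableTopology X] [MeasurableSpace X] [BorelSpace X]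
    (κ : X → X → ℝ≥0∞) (hκ : IsPerfectKernel κ) (hdom : DominationPrinciple κ)
    (hmax : ∃ M : ℝ≥0, 1 ≤ M ∧ UgaheriPrinciple κ M)
    (A : Set X) (hA : 0 < innerCapacity κ A) (hAclosed : IsStronglyClosedOn κ A)
    (ω : Measure X) (hωRadon : ω ∈ radonCone X) (hω0 : ω ≠ 0)
    (hω : ω ∈ finiteEnergyCone κ ∨ IsAdmissibleCharge κ A ω) :
    (∃! ωA : Measure X, IsInnerBalayage κ A ω ωA) ∧
    ∀ ωA : Measure X, IsInnerBalayage κ A ω ωA →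
      ((innerCapacity κ A < ∞ ∨ ωA univ = 1 → ∃! ν : Measure X, IsGaussSolution κ A ω ν) ∧
        (ωA univ = 1 → ∀ ν : Measure X, IsGaussSolution κ A ω ν ↔ ν = ωA)) ∧
      (innerCapacity κ A = ∞ ∧ ωA univ < 1 → ¬ ∃ ν : Measure X, IsGaussSolution κ A ω ν) ∧
      (FrostmanPrinciple κ → 1 < ωA univ → ∃! ν : Measure X, IsGaussSolution κ A ω ν) := by
  refine ⟨?_, fun σ hσ => ⟨⟨fun h => ?_, fun h1 ν => ?_⟩, ?_, fun _ h1 => ?_⟩⟩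
  · obtain ⟨σ, hσ⟩ : ∃ σ, IsInnerBalayage κ A ω σ := by
      rcases hω with hω | hω
      · exact hκ.exists_innerBalayage_of_mem hdom hAclosed hω
      · obtain ⟨M, -, hM⟩ := hmax
        exact hκ.exists_innerBalayage_of_isAdmissibleCharge hdom hM hAclosed hωRadon hω
    exact ⟨σ, hσ, fun τ hτ => hκ.eq_of_isInnerBalayage hωRadon hτ hσ⟩
  · obtain ⟨ν, hν⟩ : ∃ ν, IsGaussSolution κ A ω ν := by
      rcases h with h | h
      · exact hκ.exists_isGaussSolution_of_finite hA h hAclosed hωRadon hσ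
      · exact ⟨σ, hκ.isGaussSolution_of_unit hωRadon hσ h⟩
    exact ⟨ν, hν, fun τ hτ => hκ.isGaussSolution_unique hωRadon hσ hτ hν⟩
  · have hsol := hκ.isGaussSolution_of_unit hωRadon hσ h1
    exact ⟨fun hν => hκ.isGaussSolution_unique hωRadon hσ hν hsol, fun hν => hν ▸ hsol⟩
  · exact fun h => hκ.not_exists_isGaussSolution hωRadon h.1 hσ h.2
  · obtain ⟨ν, hν⟩ := hκ.exists_isGaussSolution_of_one_lt hAclosed hωRadon hσ h1
    exact ⟨ν, hν, fun τ hτ => hκ.isGaussSolution_unique hωRadon hσ hτ hν⟩
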